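/- All graphs are finite and simple. A path of a graph $G$ is induced if no edge of $G$ joins two nonconsecutive vertices of the path. A set $S\subseteq V(G)$ is m-convex if every induced path of $G$ with both end-vertices in $S$ has all its vertices in $S$. An m-convex $2$-cover of $G$ is a pair of m-convex sets $V_1,V_2\neq V(G)$ with $V_1\cup V_2=V(G)$. A clique separator of $G$ is a (possibly empty) clique $K$ such that $G-K$ is disconnected, i.e. has at least two connected components (so the empty set is a clique separator of every disconnected graph). $G$ is co-bipartite if its complement is bipartite. Theorem. (a) There is an algorithm that decides, given a graph $G$ with $n$ vertices and $m$ edges by its adjacency lists, whether $G$ has an m-convex $2$-cover, and that also decides whether $G$ has a clique separator and outputs one if so. It runs in time $O(nm)$, precisely in at most $C\cdot\max(n,1)\cdot\max(m,1)$ steps for a constant $C$, on a unit-cost random access machine with registers and arrays of natural numbers whose only arithmetic operations are adding and subtracting one. (b) If $G$ has a clique separator, then $G$ has an m-convex $2$-cover. (c) If $G$ has at least two vertices and no clique separator, then $G$ has an m-convex $2$-cover if and only if $G$ is co-bipartite. -/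

import Mathlib

namespace MonophonicCover

/-! ### Monophonic convexity -/

section Convexity

variable {V : Type*} (G : SimpleGraph V)

/-- A walk is an induced path if it is a path and every edge of the graph that joins two vertices of
the path is an edge of the path. -/
def IsInducedPath {u v : V} (w : G.Walk u v) : Prop :=
  w.IsPath ∧ w.toSubgraph.IsInduced

/-- A set is m-convex if every induced path with both end-vertices in the set is contained in it. -/
def MConvex (S : Set V) : Prop :=
  ∀ ⦃u v : V⦄, u ∈ S → v ∈ S → ∀ w : G.Walk u v, IsInducedPath G w → ∀ x ∈ w.support, x ∈ S

/-- The graph has an m-convex `p`-cover: `p` m-convex sets, each different from the whole vertex set,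
whose union is the whole vertex set. -/
def HasMConvexCover (p : ℕ) : Prop :=
  ∃ F : Fin p → Set V, (∀ i, MConvex G (F i) ∧ F i ≠ Set.univ) ∧ ⋃ i, F i = Set.univ

/-- A (possibly empty) clique whose removal leaves a disconnected graph, that is, two vertices outside
the clique with no walk between them outside the clique. The graph with no vertices does not count as
disconnected. -/
def IsCliqueSeparator (K : Set V) : Prop :=
  G.IsClique K ∧ ¬ (G.induce Kᶜ).Preconnected

/-- The complement of the graph is bipartite. -/
def IsCoBipartite : Prop :=
  Gᶜ.IsBipartite

end Convexity

/-! ### A random access machine with unit-cost steps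

Memory consists of registers and arrays that hold natural numbers. A program is a finite object that
names finitely many registers and arrays. The only arithmetic is adding or subtracting one, so that
after `t` steps every stored number is at most `t` plus the largest number in the input and in the
program text: no step handles numbers of superpolynomial size. -/

/-- A memory state: `reg x` is the content of register `x`, and `mem a i` is the content of cell `i`
of array `a`. -/
@[ext]
structure State where
  reg : ℕ → ℕ
  mem : ℕ → ℕ → ℕ

namespace State

/-- Write `k` into register `x`. -/
def setReg (s : State) (x k : ℕ) : State :=
  { s with reg := Function.update s.reg x k }

/-- Write `k` into cell `i` of array `a`. -/
def setMem (s : State) (a i k : ℕ) : State :=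
  { s with mem := Function.update s.mem a (Function.update (s.mem a) i k) }

end State

/-- Comparisons of the contents of two registers. -/
inductive Test where
  | lt (x y : ℕ)
  | le (x y : ℕ)
  | eq (x y : ℕ)
  | ne (x y : ℕ)

/-- The test succeeds in the state `s`. -/
def Test.Holds (s : State) : Test → Prop
  | .lt x y => s.reg x < s.reg y
  | .le x y => s.reg x ≤ s.reg y
  | .eq x y => s.reg x = s.reg y
  | .ne x y => s.reg x ≠ s.reg y

/-- Elementary instructions; `x`, `y` name registers, `a` names an array, `k` is a constant. -/
inductive Instr where
  /-- `x := k` -/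
  | const (x k : ℕ)
  /-- `x := y` -/
  | copy (x y : ℕ)
  /-- `x := x + 1` -/
  | inc (x : ℕ)
  /-- `x := x - 1`, and `0` stays `0` -/
  | dec (x : ℕ)
  /-- `x := a[y]` -/
  | load (x a y : ℕ)
  /-- `a[y] := x` -/
  | store (a y x : ℕ)

/-- The effect of an elementary instruction. -/
def Instr.exec (s : State) : Instr → State
  | .const x k => s.setReg x k
  | .copy x y => s.setReg x (s.reg y)
  | .inc x => s.setReg x (s.reg x + 1)
  | .dec x => s.setReg x (s.reg x - 1)
  | .load x a y => s.setReg x (s.mem a (s.reg y))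
  | .store a y x => s.setMem a (s.reg y) (s.reg x)

/-- Programs. -/
inductive Program where
  | skip
  | instr (i : Instr)
  | seq (p q : Program)
  | ite (b : Test) (p q : Program)
  | loop (b : Test) (p : Program)

/-- `Runs p s t s'`: started in the state `s`, the program `p` halts after exactly `t` steps in the
state `s'`. Every elementary instruction, every evaluation of a test and every `skip` is one step. -/
inductive Runs : Program → State → ℕ → State → Prop where
  | skip (s : State) : Runs .skip s 1 s
  | instr (i : Instr) (s : State) : Runs (.instr i) s 1 (i.exec s)
  | seq {p q : Program} {s s' s'' : State} {t t' : ℕ} :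
      Runs p s t s' → Runs q s' t' s'' → Runs (.seq p q) s (t + t') s''
  | ite_true {b : Test} {p q : Program} {s s' : State} {t : ℕ} :
      b.Holds s → Runs p s t s' → Runs (.ite b p q) s (t + 1) s'
  | ite_false {b : Test} {p q : Program} {s s' : State} {t : ℕ} :
      ¬ b.Holds s → Runs q s t s' → Runs (.ite b p q) s (t + 1) s'
  | loop_done {b : Test} {p : Program} {s : State} :
      ¬ b.Holds s → Runs (.loop b p) s 1 s
  | loop_step {b : Test} {p : Program} {s s' s'' : State} {t t' : ℕ} :
      b.Holds s → Runs p s t s' → Runs (.loop b p) s' t' s'' →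
      Runs (.loop b p) s (t + t' + 1) s''

/-! ### Graphs as inputs -/

/-- `L v` lists the neighbours of `v`, each exactly once, in any order. -/
def IsAdjacencyList {n : ℕ} (G : SimpleGraph (Fin n)) (L : Fin n → List (Fin n)) : Prop :=
  ∀ v, (L v).Nodup ∧ ∀ w, w ∈ L v ↔ G.Adj v w

/-- The initial state for adjacency lists `L` of a graph with vertices `0, …, n - 1`: register `0`
holds `n`, array `1` holds the concatenation of the lists, and cell `i ≤ n` of array `0` holds the
total length of the first `i` lists, so that the list of `v` occupies the cells `j` of array `1` with
`array0[v] ≤ j < array0[v + 1]`. Everything else is `0`. -/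
def inputState {n : ℕ} (L : Fin n → List (Fin n)) : State where
  reg x := if x = 0 then n else 0
  mem a i :=
    if a = 0 ∧ i ≤ n then ((List.ofFn fun v => (L v).length).take i).sum
    else if a = 1 then ((List.ofFn L).flatten.map Fin.val).getD i 0
    else 0

/-- The program `p` solves the problem on the graph `G`, given by the adjacency lists `L`, within `T`
steps. On halting, register `0` holds the answer (`1` if there is an m-convex 2-cover, `0` if not);
register `1` holds `1` or `0` according to whether a clique separator exists, and if one exists, then
the vertices `v` with `array2[v] = 1` form one. -/
def SolvesWithin (p : Program) {n : ℕ} (G : SimpleGraph (Fin n)) (L : Fin n → List (Fin n))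
    (T : ℕ) : Prop :=
  ∃ (t : ℕ) (s : State), Runs p (inputState L) t s ∧ t ≤ T ∧
    (HasMConvexCover G 2 → s.reg 0 = 1) ∧
    (¬ HasMConvexCover G 2 → s.reg 0 = 0) ∧
    ((∃ K, IsCliqueSeparator G K) →
      s.reg 1 = 1 ∧ IsCliqueSeparator G {v : Fin n | s.mem 2 v = 1}) ∧
    ((¬ ∃ K, IsCliqueSeparator G K) → s.reg 1 = 0)

end MonophonicCover

open MonophonicCover

/-! Clique separators give covers. If a clique `K` separates `a` from `b` and `C` is the component
of `a` in `G - K`, then `K ∪ C` and the complement of `C` form an m-convex 2-cover: an induced path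
that leaves one of these sets and returns meets `K` on both sides of the excursion, and the edge
between these two vertices of `K` would be a chord.

Without a clique separator every proper m-convex set `S` is a clique. For `x ∉ S` let `N` be the set
of vertices of `S` with a neighbour in the component of `x` in `G - S`. Two nonadjacent vertices of
`N` would be joined by an induced path with interior outside `S`, so `N` is a clique; it would
separate `x` from any vertex of `S \ N`, so `S = N`. Since cliques are m-convex, a cover then
amounts to covering the vertices by two proper cliques, that is, to a 2-colouring of the complement.

The algorithm grows a set `H` no two vertices of which are separated by a clique. Let `D` be the
component of some `v ∉ H` in `G - H` and `N` the set of its neighbours in `H`. If `N` is a clique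
and `D ∪ N` is not everything, `N` is a clique separator. Otherwise `H` can be enlarged by a vertex
of `D`: choose `T ⊆ N` greedily such that `T` has a common neighbour in `D`. If `T = N`, add such a
common neighbour (`Inseparable.insert_of_dominating`). If some `f ∈ N` was left out, no vertex of
`D` is adjacent to all of `T` and to `f`; walk from `f` through `D` and add the first common
neighbour of `T` (`Inseparable.insert_of_reach`). When `H` is everything, there is no clique
separator.

A round takes `O(n + m)` steps and there are at most `n` rounds. The bound becomes `O(nm)` because
the first round, with `H = ∅`, already finds the empty separator of a disconnected graph; in every
longer run the graph is connected and `n ≤ m + 1`. The complement is 2-coloured without being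
constructed: each vertex costs one pass over all vertices and its own adjacency list. -/

namespace MonophonicCover

/-! ### Reachability through a set of vertices -/

section Reachability

variable {V : Type*} {G : SimpleGraph V}

/-- `b` can be reached from `a` by a walk all of whose vertices after the first lie in `A`. -/
def ReachIn (G : SimpleGraph V) (A : Set V) : V → V → Prop :=
  Relation.ReflTransGen fun x y => G.Adj x y ∧ y ∈ A

theorem ReachIn.mem {A : Set V} {a b : V} (h : ReachIn G A a b) (ha : a ∈ A) : b ∈ A := by
  induction h with
  | refl => exact ha
  | tail _ h _ => exact h.2

theorem ReachIn.mem_of_ne {A : Set V} {a b : V} (h : ReachIn G A a b) (hab : b ≠ a) : b ∈ A := by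
  cases h with
  | refl => exact absurd rfl hab
  | tail _ h => exact h.2

theorem ReachIn.mono {A B : Set V} {a b : V} (h : ReachIn G A a b) (hAB : A ⊆ B) :
    ReachIn G B a b :=
  Relation.ReflTransGen.mono (r := fun x y => G.Adj x y ∧ y ∈ A)
    (p := fun x y => G.Adj x y ∧ y ∈ B) (fun _ _ h => ⟨h.1, hAB h.2⟩) _ _ h

theorem ReachIn.trans {A : Set V} {a b c : V} (h : ReachIn G A a b) (h' : ReachIn G A b c) :
    ReachIn G A a c :=
  Relation.ReflTransGen.trans h h'

theorem ReachIn.of_adj {A : Set V} {a b : V} (h : G.Adj a b) (hb : b ∈ A) : ReachIn G A a b :=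
  Relation.ReflTransGen.single ⟨h, hb⟩

/-- The start of a walk is free, but on reversal it becomes the end, hence `a ∈ A`. The free start
lets the later searches begin at a vertex of `H` and run through a component of `G - H`. -/
theorem ReachIn.symm {A : Set V} {a b : V} (h : ReachIn G A a b) (ha : a ∈ A) :
    ReachIn G A b a := by
  induction h with
  | refl => exact .refl
  | tail h1 h ih => exact (ReachIn.of_adj h.1.symm (ReachIn.mem h1 ha)).trans ih

/-- Every step of the walk can be recorded as belonging to the set of reachable vertices. -/
theorem ReachIn.within {A : Set V} {a b : V} (h : ReachIn G A a b) :
    ReachIn G {x | x ∈ A ∧ ReachIn G A a x} a b := by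
  induction h with
  | refl => exact .refl
  | tail h1 h ih => exact ih.trans (.of_adj h.1 ⟨h.2, Relation.ReflTransGen.tail h1 h⟩)

theorem ReachIn.exists_walk {A : Set V} {a b : V} (h : ReachIn G A a b) :
    ∃ w : G.Walk a b, ∀ x ∈ w.support, x = a ∨ x ∈ A := by
  induction h using Relation.ReflTransGen.head_induction_on with
  | refl => exact ⟨.nil, by simp⟩
  | head h _ ih =>
    obtain ⟨w, hw⟩ := ih
    refine ⟨.cons h.1 w, fun x hx => ?_⟩
    rw [SimpleGraph.Walk.support_cons, List.mem_cons] at hx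
    rcases hx with rfl | hx
    · exact .inl rfl
    · rcases hw x hx with rfl | hx
      exacts [.inr h.2, .inr hx]

theorem induce_preconnected_iff {A : Set V} :
    (G.induce A).Preconnected ↔ ∀ a ∈ A, ∀ b ∈ A, ReachIn G A a b := by
  constructor
  · intro h a ha b hb
    obtain ⟨w⟩ := h ⟨a, ha⟩ ⟨b, hb⟩
    have key : ∀ {x y : A} (_ : (G.induce A).Walk x y), ReachIn G A x y := by
      intro x y w
      induction w with
      | nil => exact .refl
      | cons h p ih => exact (ReachIn.of_adj (by simpa using h) (Subtype.coe_prop _)).trans ih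
    exact key w
  · rintro h ⟨a, ha⟩ ⟨b, hb⟩
    have key : ∀ {b : V} (_ : ReachIn G A a b) (hb : b ∈ A),
        (G.induce A).Reachable ⟨a, ha⟩ ⟨b, hb⟩ := by
      intro b h
      induction h with
      | refl => exact fun _ => .refl _
      | tail h1 h ih =>
        intro hb
        have hm := ReachIn.mem h1 ha
        refine (ih hm).trans (SimpleGraph.Adj.reachable ?_)
        simpa using h.1
    exact key (h a ha b hb) hb

theorem isCliqueSeparator_iff {K : Set V} :
    IsCliqueSeparator G K ↔
      G.IsClique K ∧ ∃ a ∉ K, ∃ b ∉ K, ¬ ReachIn G Kᶜ a b := by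
  unfold IsCliqueSeparator
  rw [induce_preconnected_iff]
  simp

end Reachability

/-! ### Clique separators and m-convex sets -/

section Convex

variable {V : Type*} {G : SimpleGraph V}

/-- A step out of `S` can only be made from a vertex of `K`. -/
theorem exists_mem_support_of_boundary {K S : Set V} (hb : ∀ a ∈ S, a ∉ K → ∀ b, G.Adj a b → b ∈ S)
    {u v : V} (w : G.Walk u v) (hu : u ∈ S) (hv : v ∉ S) : ∃ k ∈ w.support, k ∈ K ∧ k ∈ S := by
  induction w with
  | nil => exact absurd hu hv
  | @cons a b c h p ih =>
    by_cases ha : a ∈ K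
    · exact ⟨a, by simp, ha, hu⟩
    · obtain ⟨k, hk, hk'⟩ := ih (hb a hu ha b h) hv
      exact ⟨k, by simp [hk], hk'⟩

/-- A set whose vertices with neighbours outside form a clique is m-convex. -/
theorem mConvex_of_boundary {K S : Set V} (hK : G.IsClique K)
    (hb : ∀ a ∈ S, a ∉ K → ∀ b, G.Adj a b → b ∈ S) : MConvex G S := by
  classical
  intro u v hu hv w hw x hx
  by_contra hxS
  have hspec := w.take_spec hx
  have hnd := hw.1.support_nodup
  rw [← hspec, SimpleGraph.Walk.support_append] at hnd
  have hd := List.disjoint_of_nodup_append hnd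
  have hd' : ∀ y, y ∈ (w.takeUntil x hx).support → y ∈ (w.dropUntil x hx).support → y = x := by
    intro y h1 h2
    rw [← SimpleGraph.Walk.cons_tail_support (w.dropUntil x hx), List.mem_cons] at h2
    exact h2.resolve_right (hd h1)
  -- The path is cut at `x ∉ S`. Both halves join `S` to `x`, so each contains a vertex of `K ∩ S`;
  -- the halves share only `x`, hence `k ≠ l`.
  obtain ⟨k, hk, hkK, hkS⟩ := exists_mem_support_of_boundary hb (w.takeUntil x hx) hu hxS
  obtain ⟨l, hl, hlK, hlS⟩ := exists_mem_support_of_boundary hb (w.dropUntil x hx).reverse hv hxS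
  rw [SimpleGraph.Walk.support_reverse, List.mem_reverse] at hl
  have hkl : k ≠ l := fun h => hxS (hd' k hk (h ▸ hl) ▸ hkS)
  -- As the path is induced, `kl` is one of its edges and lies in one half. Then `k` or `l` lies in
  -- both halves and equals `x`, which is not in `S`.
  have he := hw.2 (v := k)
    (by simpa using SimpleGraph.Walk.support_takeUntil_subset_support _ hx hk)
    (w := l) (by simpa using SimpleGraph.Walk.support_dropUntil_subset_support _ hx hl)
    (hK hkK hlK hkl)
  rw [SimpleGraph.Walk.adj_toSubgraph_iff_mem_edges, ← hspec, SimpleGraph.Walk.edges_append,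
    List.mem_append] at he
  rcases he with he | he
  · exact hxS (hd' l (SimpleGraph.Walk.snd_mem_support_of_mem_edges _ he) hl ▸ hlS)
  · exact hxS (hd' k hk (SimpleGraph.Walk.fst_mem_support_of_mem_edges _ he) ▸ hkS)

theorem mConvex_of_isClique {S : Set V} (hS : G.IsClique S) : MConvex G S :=
  mConvex_of_boundary hS fun _ h h' => absurd h h'

theorem hasMConvexCover_two_iff :
    HasMConvexCover G 2 ↔ ∃ A B : Set V, MConvex G A ∧ MConvex G B ∧ A ≠ Set.univ ∧
      B ≠ Set.univ ∧ A ∪ B = Set.univ := by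
  constructor
  · rintro ⟨F, hF, hU⟩
    refine ⟨F 0, F 1, (hF 0).1, (hF 1).1, (hF 0).2, (hF 1).2, ?_⟩
    rw [← hU]; ext x; simp
  · rintro ⟨A, B, hA, hB, hA', hB', hU⟩
    refine ⟨![A, B], ?_, ?_⟩
    · intro i; fin_cases i <;> simp [*]
    · rw [← hU]; ext x; simp

/-- Every vertex outside `K` has all its neighbours in `K` or in its own component of `G - K`, so
`mConvex_of_boundary` applies both to the component of `a` together with `K` and to the complement
of the component. The first set misses `b`, the second misses `a`. -/
theorem hasMConvexCover_of_isCliqueSeparator {K : Set V} (h : IsCliqueSeparator G K) :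
    HasMConvexCover G 2 := by
  obtain ⟨hK, a, ha, b, hb, hab⟩ := isCliqueSeparator_iff.1 h
  rw [hasMConvexCover_two_iff]
  have hC : ∀ x y, ReachIn G Kᶜ a x → G.Adj x y → y ∉ K → ReachIn G Kᶜ a y :=
    fun x y hx hxy hy => hx.trans (.of_adj hxy hy)
  refine ⟨K ∪ {x | ReachIn G Kᶜ a x}, {x | ReachIn G Kᶜ a x}ᶜ, ?_, ?_, ?_, ?_, ?_⟩
  · refine mConvex_of_boundary hK fun x hx hxK y hxy => ?_
    by_cases hy : y ∈ K
    · exact .inl hy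
    · exact .inr (hC x y (hx.resolve_left hxK) hxy hy)
  · refine mConvex_of_boundary hK fun x hx hxK y hxy hy => hx ?_
    exact hC y x hy hxy.symm hxK
  · intro h
    exact (h ▸ Set.mem_univ b : b ∈ K ∪ {x | ReachIn G Kᶜ a x}).elim hb hab
  · intro h
    exact (h ▸ Set.mem_univ a : a ∈ {x | ReachIn G Kᶜ a x}ᶜ) .refl
  · ext x
    by_cases hx : ReachIn G Kᶜ a x <;> simp [hx]

/-- A shortest walk among those inside a set of vertices is an induced path. -/
theorem exists_isInducedPath {A : Set V} {a b : V} (w : G.Walk a b) (hw : ∀ x ∈ w.support, x ∈ A) :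
    ∃ p : G.Walk a b, IsInducedPath G p ∧ ∀ x ∈ p.support, x ∈ A := by
  classical
  have hex : ∃ n, ∃ p : G.Walk a b, (∀ x ∈ p.support, x ∈ A) ∧ p.length = n := ⟨_, w, hw, rfl⟩
  obtain ⟨p₀, hp₀, hl₀⟩ := Nat.find_spec hex
  have hmin : ∀ q : G.Walk a b, (∀ x ∈ q.support, x ∈ A) → p₀.length ≤ q.length :=
    fun q hq => hl₀ ▸ Nat.find_min' hex ⟨q, hq, rfl⟩
  obtain ⟨p, hp, hpA, hpl⟩ : ∃ p : G.Walk a b, p.IsPath ∧ (∀ x ∈ p.support, x ∈ A) ∧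
      p.length ≤ p₀.length :=
    ⟨p₀.bypass, p₀.bypass_isPath, fun x hx => hp₀ x (p₀.support_bypass_subset_support hx),
      p₀.length_bypass_le_length⟩
  -- Replacing the segment `p₂` by the edge `xy` gives a walk inside `A`. By minimality `p₂` has at
  -- most one edge, and then it is that edge.
  have key : ∀ x y (p₁ : G.Walk a x) (p₂ : G.Walk x y) (p₃ : G.Walk y b),
      p = p₁.append (p₂.append p₃) → G.Adj x y → s(x, y) ∈ p.edges := by
    intro x y p₁ p₂ p₃ he hxy
    have h1 := hmin (p₁.append (.cons hxy p₃)) (by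
      intro z hz
      refine hpA z ?_
      rw [he]
      simp only [SimpleGraph.Walk.mem_support_append_iff, SimpleGraph.Walk.support_cons,
        List.mem_cons] at hz ⊢
      rcases hz with hz | rfl | hz
      · exact .inl hz
      · exact .inl p₁.end_mem_support
      · exact .inr (.inr hz))
    have h2 := congrArg SimpleGraph.Walk.length he
    simp only [SimpleGraph.Walk.length_append, SimpleGraph.Walk.length_cons] at h1 h2
    have h4 : p₂.length ≤ 1 := by omega
    have h5 : s(x, y) ∈ p₂.edges := by
      cases p₂ with
      | nil => exact absurd rfl hxy.ne
      | cons h q =>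
        cases q with
        | nil => simp
        | cons h' q => simp at h4
    rw [he, SimpleGraph.Walk.edges_append, SimpleGraph.Walk.edges_append]
    simp [h5]
  refine ⟨p, ⟨hp, ?_⟩, hpA⟩
  intro x hx y hy hxy
  rw [SimpleGraph.Walk.adj_toSubgraph_iff_mem_edges]
  replace hx : x ∈ p.support := by simpa using hx
  replace hy : y ∈ p.support := by simpa using hy
  have hs := p.take_spec hx
  rw [← hs, SimpleGraph.Walk.mem_support_append_iff] at hy
  rcases hy with h | h
  · rw [Sym2.eq_swap]
    refine key y x ((p.takeUntil x hx).takeUntil y h) ((p.takeUntil x hx).dropUntil y h) (p.dropUntil x hx) ?_ hxy.symm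
    rw [SimpleGraph.Walk.append_assoc, SimpleGraph.Walk.take_spec, hs]
  · refine key x y (p.takeUntil x hx) ((p.dropUntil x hx).takeUntil y h)
      ((p.dropUntil x hx).dropUntil y h) ?_ hxy
    rw [SimpleGraph.Walk.take_spec, hs]

/-- `N` is the neighbourhood in `S` of the component of `x` in `G - S`. Convexity makes `N` a
clique, and the absence of clique separators forces `S ⊆ N`. -/
theorem isClique_of_mConvex (hsep : ¬ ∃ K, IsCliqueSeparator G K) {S : Set V} (hS : MConvex G S)
    (hne : S ≠ Set.univ) : G.IsClique S := by
  obtain ⟨x, hx⟩ := (Set.ne_univ_iff_exists_notMem S).1 hne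
  set N : Set V := {s | s ∈ S ∧ ∃ d, ReachIn G Sᶜ x d ∧ G.Adj d s} with hN
  have hcl : G.IsClique N := by
    rintro a ⟨haS, d, hd, hda⟩ b ⟨hbS, e, he, heb⟩ hab
    by_contra hadj
    have hde := ((hd.symm hx).trans he).within
    obtain ⟨w, hw⟩ := hde.exists_walk
    have hdS : d ∈ Sᶜ := hd.mem hx
    -- An induced path from `a` to `b` whose other vertices avoid `S`. Its second vertex is not `b`,
    -- since `a` and `b` are not adjacent, so it lies outside `S` and contradicts convexity.
    obtain ⟨p, hp, hpA⟩ := exists_isInducedPath (A := {a, b} ∪ Sᶜ)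
      (SimpleGraph.Walk.cons hda.symm (w.concat heb)) (by
        intro y hy
        simp only [SimpleGraph.Walk.support_cons, SimpleGraph.Walk.support_concat, List.mem_cons,
          List.mem_append, List.not_mem_nil, or_false] at hy
        rcases hy with rfl | hy | rfl
        · simp
        · rcases hw y hy with rfl | hy
          exacts [.inr hdS, .inr hy.1]
        · simp)
    cases p with
    | nil => exact hab rfl
    | @cons _ c _ h q =>
      have hc := hpA c (by simp)
      rcases hc with (rfl | rfl) | hc
      · exact h.ne rfl
      · exact hadj h
      · exact hc (hS haS hbS _ hp c (by simp))
  have hsub : S ⊆ N := by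
    intro s hs
    by_contra hsN
    refine hsep ⟨N, isCliqueSeparator_iff.2 ⟨hcl, x, fun h => hx h.1, s, hsN, fun h => ?_⟩⟩
    -- A walk from `x` that enters `S` does so at a vertex of `N`; avoiding `N` it avoids `S`.
    have key : ∀ y, ReachIn G Nᶜ x y → ReachIn G Sᶜ x y := by
      intro y hy
      induction hy with
      | refl => exact .refl
      | tail _ h ih =>
        refine ih.trans (.of_adj h.1 fun hS => h.2 ⟨hS, _, ih, h.1⟩)
    exact (key s h).mem hx hs
  exact hcl.subset hsub

theorem hasMConvexCover_iff_isCoBipartite [Nontrivial V] (hsep : ¬ ∃ K, IsCliqueSeparator G K) :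
    HasMConvexCover G 2 ↔ IsCoBipartite G := by
  classical
  constructor
  · intro h
    obtain ⟨A, B, hA, hB, hA', hB', hU⟩ := hasMConvexCover_two_iff.1 h
    have hcA := isClique_of_mConvex hsep hA hA'
    have hcB := isClique_of_mConvex hsep hB hB'
    refine ⟨SimpleGraph.Coloring.mk (fun v => if v ∈ A then (0 : Fin 2) else 1) ?_⟩
    intro v w hvw heq
    rw [SimpleGraph.compl_adj] at hvw
    have hB : ∀ x, x ∉ A → x ∈ B := fun x hx =>
      ((hU ▸ Set.mem_univ x : x ∈ A ∪ B)).resolve_left hx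
    by_cases hv : v ∈ A <;> by_cases hw : w ∈ A <;> simp [hv, hw] at heq
    · exact hvw.2 (hcA hv hw hvw.1)
    · exact hvw.2 (hcB (hB v hv) (hB w hw) hvw.1)
  · rintro ⟨C⟩
    have hcl : ∀ i, G.IsClique {v | C v = i} := by
      intro i v hv w hw hvw
      by_contra hadj
      exact C.valid ((SimpleGraph.compl_adj ..).2 ⟨hvw, hadj⟩) (hv.trans hw.symm)
    rw [hasMConvexCover_two_iff]
    -- If only one colour occurs, its class is not a proper subset. The graph is then complete, and
    -- any split into two nonempty sets will do.
    by_cases hall : ∃ i, ∀ v, C v = i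
    · obtain ⟨i, hi⟩ := hall
      obtain ⟨x, y, hxy⟩ := exists_pair_ne V
      have hG : ∀ S : Set V, G.IsClique S := fun S => (hcl i).subset fun v _ => hi v
      refine ⟨{x}, {x}ᶜ, mConvex_of_isClique (hG _), mConvex_of_isClique (hG _), ?_, ?_, ?_⟩
      · exact fun h => hxy.symm (h ▸ Set.mem_univ y : y ∈ ({x} : Set V))
      · exact fun h => (h ▸ Set.mem_univ x : x ∈ ({x} : Set V)ᶜ) rfl
      · exact Set.union_compl_self _
    · push Not at hall
      refine ⟨{v | C v = 0}, {v | C v = 1}, mConvex_of_isClique (hcl 0), mConvex_of_isClique (hcl 1),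
        ?_, ?_, ?_⟩
      · obtain ⟨v, hv⟩ := hall 0
        exact fun h => hv (h ▸ Set.mem_univ v : v ∈ {v | C v = 0})
      · obtain ⟨v, hv⟩ := hall 1
        exact fun h => hv (h ▸ Set.mem_univ v : v ∈ {v | C v = 1})
      · ext v
        have : C v = 0 ∨ C v = 1 := by
          rcases C v with ⟨_ | _ | k, hk⟩
          · exact .inl rfl
          · exact .inr rfl
          · omega
        simpa using this

end Convex

/-! ### Inseparable sets -/

section Inseparable

variable {V : Type*} {G : SimpleGraph V}

/-- No clique separates two vertices of the set from each other. -/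
def Inseparable (G : SimpleGraph V) (H : Set V) : Prop :=
  ∀ K, G.IsClique K → ∀ a ∈ H, a ∉ K → ∀ b ∈ H, b ∉ K → ReachIn G Kᶜ a b

theorem inseparable_empty : Inseparable G ∅ :=
  fun _ _ _ ha => absurd ha (Set.notMem_empty _)

theorem Inseparable.not_isCliqueSeparator (h : Inseparable G Set.univ) :
    ¬ ∃ K, IsCliqueSeparator G K := by
  rintro ⟨K, hK⟩
  obtain ⟨hK, a, ha, b, hb, hab⟩ := isCliqueSeparator_iff.1 hK
  exact hab (h K hK a trivial ha b trivial hb)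

/-- It suffices that `z` reaches a single vertex of `H` outside `K`; inseparability of `H` takes
care of the others. -/
theorem Inseparable.insert {H : Set V} (h : Inseparable G H) {z : V}
    (hz : ∀ K, G.IsClique K → z ∉ K → (∃ a ∈ H, a ∉ K) → ∃ b ∈ H, b ∉ K ∧ ReachIn G Kᶜ z b) :
    Inseparable G (insert z H) := by
  have key : ∀ K, G.IsClique K → z ∉ K → ∀ a ∈ H, a ∉ K → ReachIn G Kᶜ z a := by
    intro K hK hzK a ha haK
    obtain ⟨b, hb, hbK, hzb⟩ := hz K hK hzK ⟨a, ha, haK⟩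
    exact hzb.trans (h K hK b hb hbK a ha haK)
  intro K hK a ha haK b hb hbK
  rcases ha with rfl | ha <;> rcases hb with rfl | hb
  · exact .refl
  · exact key K hK haK b hb hbK
  · exact (key K hK hbK a ha haK).symm hbK
  · exact h K hK a ha haK b hb hbK

/-- The component of `v` in the graph without `H`. -/
def compOf (G : SimpleGraph V) (H : Set V) (v : V) : Set V :=
  {d | ReachIn G Hᶜ v d}

/-- The vertices of `H` that have a neighbour in the component of `v`. -/
def attach (G : SimpleGraph V) (H : Set V) (v : V) : Set V :=
  {h | h ∈ H ∧ ∃ d ∈ compOf G H v, G.Adj d h}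

theorem notMem_of_mem_compOf {H : Set V} {v d : V} (hv : v ∉ H) (hd : d ∈ compOf G H v) : d ∉ H :=
  ReachIn.mem (A := Hᶜ) hd hv

/-- A walk from `v` can leave its component of `G - H` only through an attached vertex. -/
theorem isCliqueSeparator_attach {H : Set V} {v : V} (hv : v ∉ H)
    (hK : G.IsClique (attach G H v)) {x : V} (hx : x ∉ compOf G H v) (hx' : x ∉ attach G H v) :
    IsCliqueSeparator G (attach G H v) := by
  refine isCliqueSeparator_iff.2 ⟨hK, v, fun h => hv h.1, x, hx', fun h => hx ?_⟩
  have key : ∀ y, ReachIn G (attach G H v)ᶜ v y → y ∈ compOf G H v := by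
    intro y hy
    induction hy with
    | refl => exact .refl
    | tail _ h ih =>
      exact ReachIn.trans ih (.of_adj h.1 fun hH => h.2 ⟨hH, _, ih, h.1⟩)
  exact key x h

/-- Every two vertices of a component are joined inside the component. -/
theorem reachIn_compOf {H : Set V} {v d e : V} (hv : v ∉ H) (hd : d ∈ compOf G H v)
    (he : e ∈ compOf G H v) : ReachIn G (compOf G H v) d e := by
  have h := (((show ReachIn G Hᶜ v d from hd).symm hv).trans he).within
  exact h.mono fun x hx => ReachIn.trans hd hx.2

/-- If all attached vertices lie in `K`, they form a clique, so by `hN` the component and the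
attached vertices are everything. As `H` avoids the component, this gives `H ⊆ K`, against the
choice of `a`. Otherwise an attached vertex outside `K` is a neighbour of `z`. -/
theorem Inseparable.insert_of_dominating {H : Set V} (h : Inseparable G H) {v z : V} (hv : v ∉ H)
    (hN : G.IsClique (attach G H v) → ∀ x, x ∈ compOf G H v ∨ x ∈ attach G H v)
    (hz : ∀ s ∈ attach G H v, G.Adj z s) : Inseparable G (Insert.insert z H) := by
  refine h.insert fun K hK hzK ⟨a, ha, haK⟩ => ?_
  by_cases hsub : attach G H v ⊆ K
  · rcases hN (hK.subset hsub) a with h1 | h1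
    · exact absurd ha (notMem_of_mem_compOf hv h1)
    · exact absurd (hsub h1) haK
  · obtain ⟨s, hs, hsK⟩ := Set.not_subset.1 hsub
    exact ⟨s, hs.1, hsK, .of_adj (hz s hs) hsK⟩

/-- Here `T` and `f` are attached to the component in such a way that no vertex of the component is
adjacent to all of them, and `z` is a vertex adjacent to all of `T` that is reached from `f` through
vertices of the component that are not. -/
theorem Inseparable.insert_of_reach {H : Set V} (h : Inseparable G H) {v z f u : V} (hv : v ∉ H)
    (hN : G.IsClique (attach G H v) → ∀ x, x ∈ compOf G H v ∨ x ∈ attach G H v)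
    {T : Set V} (hT : T ⊆ attach G H v) (hf : f ∈ attach G H v)
    (hTf : ∀ d ∈ compOf G H v, (∀ t ∈ T, G.Adj d t) → ¬ G.Adj d f)
    (hzD : z ∈ compOf G H v) (hz : ∀ t ∈ T, G.Adj z t)
    (hu : ReachIn G {d | d ∈ compOf G H v ∧ ¬ ∀ t ∈ T, G.Adj d t} f u) (huz : G.Adj u z) :
    Inseparable G (Insert.insert z H) := by
  refine h.insert fun K hK hzK ⟨a, ha, haK⟩ => ?_
  by_cases hTK : T ⊆ K
  -- A vertex of `K` in the component is adjacent to all of `T ⊆ K`. If also `f ∈ K`, it would be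
  -- adjacent to `f`, which `hTf` excludes: so `K` misses the component, and `z` can move freely in
  -- it to any attached vertex outside `K`.
  · by_cases hfK : f ∈ K
    · have hKD : ∀ d ∈ compOf G H v, d ∉ K := by
        intro d hd hdK
        have hdH := notMem_of_mem_compOf hv hd
        refine hTf d hd (fun t ht => hK hdK (hTK ht) ?_) (hK hdK hfK ?_)
        · rintro rfl; exact hdH (hT ht).1
        · rintro rfl; exact hdH hf.1
      by_cases hsub : attach G H v ⊆ K
      · rcases hN (hK.subset hsub) a with h1 | h1
        · exact absurd ha (notMem_of_mem_compOf hv h1)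
        · exact absurd (hsub h1) haK
      · obtain ⟨s, hs, hsK⟩ := Set.not_subset.1 hsub
        obtain ⟨d, hd, hds⟩ := hs.2
        exact ⟨s, hs.1, hsK, ((reachIn_compOf hv hzD hd).mono hKD).trans (.of_adj hds hsK)⟩
    -- The walk from `f` to `z` uses vertices of the component that are not adjacent to all of `T`,
    -- so none of them lies in `K`.
    · refine ⟨f, hf.1, hfK, ReachIn.symm ?_ hfK⟩
      refine ((hu.mono ?_).trans (.of_adj huz hzK))
      rintro d ⟨hd, hd'⟩ hdK
      refine hd' fun t ht => hK hdK (hTK ht) ?_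
      rintro rfl
      exact notMem_of_mem_compOf hv hd (hT ht).1
  · obtain ⟨t, ht, htK⟩ := Set.not_subset.1 hTK
    exact ⟨t, (hT ht).1, htK, .of_adj (hz t ht) htK⟩

end Inseparable

/-! ### Reasoning about programs -/

infixr:60 " ;; " => Program.seq

theorem State.reg_setReg (s : State) (x k y : ℕ) :
    (s.setReg x k).reg y = if y = x then k else s.reg y := by
  simp [State.setReg, Function.update_apply]

theorem State.mem_setReg (s : State) (x k : ℕ) : (s.setReg x k).mem = s.mem := rfl

theorem State.reg_setMem (s : State) (a i k : ℕ) : (s.setMem a i k).reg = s.reg := rfl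

theorem State.mem_setMem_ne (s : State) (a i k b : ℕ) (h : b ≠ a) :
    (s.setMem a i k).mem b = s.mem b := by
  simp [State.setMem, h]

theorem State.mem_setMem (s : State) (a i k b j : ℕ) :
    (s.setMem a i k).mem b j = if b = a ∧ j = i then k else s.mem b j := by
  unfold State.setMem
  by_cases hb : b = a
  · subst hb
    by_cases hj : j = i <;> simp [hj]
  · simp [hb]

/-- The registers that an instruction may change. -/
def Instr.regs : Instr → List ℕ
  | .const x _ => [x]
  | .copy x _ => [x]
  | .inc x => [x]
  | .dec x => [x]
  | .load x _ _ => [x]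
  | .store _ _ _ => []

/-- The arrays that an instruction may change. -/
def Instr.arrs : Instr → List ℕ
  | .store a _ _ => [a]
  | _ => []

/-- The registers that a program may change. -/
def Program.regs : Program → List ℕ
  | .skip => []
  | .instr i => i.regs
  | .seq p q => p.regs ++ q.regs
  | .ite _ p q => p.regs ++ q.regs
  | .loop _ p => p.regs

/-- The arrays that a program may change. -/
def Program.arrs : Program → List ℕ
  | .skip => []
  | .instr i => i.arrs
  | .seq p q => p.arrs ++ q.arrs
  | .ite _ p q => p.arrs ++ q.arrs
  | .loop _ p => p.arrs

/-- The states agree outside the registers and arrays that the program may change. -/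
def Frame (p : Program) (s s' : State) : Prop :=
  (∀ x, x ∉ p.regs → s'.reg x = s.reg x) ∧ ∀ a, a ∉ p.arrs → s'.mem a = s.mem a

theorem Frame.reg {p : Program} {s s' : State} (h : Frame p s s') (x : ℕ)
    (hx : x ∉ p.regs := by decide) : s'.reg x = s.reg x :=
  h.1 x hx

theorem Frame.mem {p : Program} {s s' : State} (h : Frame p s s') (a : ℕ)
    (ha : a ∉ p.arrs := by decide) : s'.mem a = s.mem a :=
  h.2 a ha

theorem Frame.refl (p : Program) (s : State) : Frame p s s :=
  ⟨fun _ _ => rfl, fun _ _ => rfl⟩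

theorem Frame.trans {p : Program} {s s' s'' : State} (h : Frame p s s') (h' : Frame p s' s'') :
    Frame p s s'' :=
  ⟨fun x hx => (h'.1 x hx).trans (h.1 x hx), fun a ha => (h'.2 a ha).trans (h.2 a ha)⟩

theorem Frame.weaken {p q : Program} {s s' : State} (h : Frame p s s')
    (hr : ∀ x ∈ p.regs, x ∈ q.regs) (ha : ∀ a ∈ p.arrs, a ∈ q.arrs) : Frame q s s' :=
  ⟨fun x hx => h.1 x fun h' => hx (hr x h'), fun a hx => h.2 a fun h' => hx (ha a h')⟩

/-- Registers and arrays are named by constants in the program text, so what a program may change is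
computed from its syntax. Preservation of data is thus settled by `decide`. -/
theorem Runs.frame {p : Program} {s s' : State} {t : ℕ} (h : Runs p s t s') : Frame p s s' := by
  induction h with
  | skip s => exact .refl _ _
  | instr i s =>
    cases i <;> constructor <;> intro x hx <;>
      simp_all [Program.regs, Program.arrs, Instr.regs, Instr.arrs, Instr.exec, State.setReg,
        State.setMem]
  | seq _ _ h1 h2 =>
    exact (h1.weaken (by simp +contextual [Program.regs]) (by simp +contextual [Program.arrs])).trans
      (h2.weaken (by simp +contextual [Program.regs]) (by simp +contextual [Program.arrs]))
  | ite_true _ _ h1 =>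
    exact h1.weaken (by simp +contextual [Program.regs]) (by simp +contextual [Program.arrs])
  | ite_false _ _ h1 =>
    exact h1.weaken (by simp +contextual [Program.regs]) (by simp +contextual [Program.arrs])
  | loop_done _ => exact .refl _ _
  | loop_step _ _ _ h1 h2 => exact Frame.trans h1 h2

/-- The program halts, and its running time and final state satisfy `Q`. -/
def WP (p : Program) (s : State) (Q : ℕ → State → Prop) : Prop :=
  ∃ t s', Runs p s t s' ∧ Q t s'

theorem WP.mono {p : Program} {s : State} {Q Q' : ℕ → State → Prop} (h : WP p s Q)
    (hQ : ∀ t s', Frame p s s' → Q t s' → Q' t s') : WP p s Q' := by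
  obtain ⟨t, s', hr, hq⟩ := h
  exact ⟨t, s', hr, hQ t s' hr.frame hq⟩

/-- This rule and those for instructions, sequences and branches are equivalences, so that `simp`
can execute straight-line code symbolically. -/
theorem wp_skip {s : State} {Q : ℕ → State → Prop} : WP .skip s Q ↔ Q 1 s := by
  constructor
  · rintro ⟨t, s', ⟨⟩, h⟩; exact h
  · exact fun h => ⟨_, _, .skip s, h⟩

theorem wp_instr {i : Instr} {s : State} {Q : ℕ → State → Prop} :
    WP (.instr i) s Q ↔ Q 1 (i.exec s) := by
  constructor
  · rintro ⟨t, s', ⟨⟩, h⟩; exact h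
  · exact fun h => ⟨_, _, .instr i s, h⟩

theorem wp_seq {p q : Program} {s : State} {Q : ℕ → State → Prop} :
    WP (p ;; q) s Q ↔ WP p s fun t s' => WP q s' fun t' s'' => Q (t + t') s'' := by
  constructor
  · rintro ⟨t, s', hr, h⟩
    cases hr with
    | seq h1 h2 => exact ⟨_, _, h1, _, _, h2, h⟩
  · rintro ⟨t, s', h1, t', s'', h2, h⟩
    exact ⟨_, _, .seq h1 h2, h⟩

theorem WP.seq {p q : Program} {s : State} {Q' Q : ℕ → State → Prop} (h : WP p s Q')
    (h' : ∀ t s', Frame p s s' → Q' t s' → WP q s' fun t' s'' => Q (t + t') s'') :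
    WP (p ;; q) s Q :=
  wp_seq.2 (h.mono h')

theorem wp_ite {b : Test} {p q : Program} {s : State} {Q : ℕ → State → Prop} :
    WP (.ite b p q) s Q ↔ (b.Holds s → WP p s fun t s' => Q (t + 1) s') ∧
      (¬ b.Holds s → WP q s fun t s' => Q (t + 1) s') := by
  constructor
  · rintro ⟨t, s', hr, h⟩
    cases hr with
    | ite_true hb hr => exact ⟨fun _ => ⟨_, _, hr, h⟩, fun hn => absurd hb hn⟩
    | ite_false hb hr => exact ⟨fun hn => absurd hn hb, fun _ => ⟨_, _, hr, h⟩⟩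
  · rintro ⟨h1, h2⟩
    by_cases hb : b.Holds s
    · obtain ⟨t, s', hr, h⟩ := h1 hb
      exact ⟨_, _, .ite_true hb hr, h⟩
    · obtain ⟨t, s', hr, h⟩ := h2 hb
      exact ⟨_, _, .ite_false hb hr, h⟩

/-- A loop with an invariant that speaks about the time elapsed, and a measure that decreases. -/
theorem WP.loop {b : Test} {p : Program} {s : State} (I : ℕ → State → Prop) (μ : State → ℕ)
    (h0 : I 0 s)
    (step : ∀ t s', Frame p s s' → I t s' → b.Holds s' →
      WP p s' fun t' s'' => I (t + t' + 1) s'' ∧ μ s'' < μ s') :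
    WP (.loop b p) s fun t s' => ∃ t₀, t = t₀ + 1 ∧ I t₀ s' ∧ ¬ b.Holds s' := by
  have key : ∀ m t s', μ s' ≤ m → Frame p s s' → I t s' →
      WP (.loop b p) s' fun t' s'' => ∃ t₀, t + t' = t₀ + 1 ∧ I t₀ s'' ∧ ¬ b.Holds s'' := by
    intro m
    induction m with
    | zero =>
      intro t s' hm hF hI
      by_cases hb : b.Holds s'
      · obtain ⟨t', s'', hr, hI', hlt⟩ := step t s' hF hI hb
        omega
      · exact ⟨1, s', .loop_done hb, t, rfl, hI, hb⟩
    | succ m ih =>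
      intro t s' hm hF hI
      by_cases hb : b.Holds s'
      · obtain ⟨t', s'', hr, hI', hlt⟩ := step t s' hF hI hb
        obtain ⟨t'', s₃, hr', t₀, ht₀, hI₀, hb₀⟩ :=
          ih (t + t' + 1) s'' (by omega) (hF.trans hr.frame) hI'
        exact ⟨t' + t'' + 1, s₃, .loop_step hb hr hr', t₀, by omega, hI₀, hb₀⟩
      · exact ⟨1, s', .loop_done hb, t, rfl, hI, hb⟩
  refine (key (μ s) 0 s le_rfl (.refl _ _) h0).mono ?_
  rintro t s' _ ⟨t₀, ht, h⟩
  exact ⟨t₀, by omega, h⟩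

/-- For `i = 0, …, n - 1`, where `n` is the content of register `0`. -/
def forV (i : ℕ) (p : Program) : Program :=
  .instr (.const i 0) ;; .loop (.lt i 0) (p ;; .instr (.inc i))

/-- `E k` bounds the time of the first `k` rounds. It need not be linear in `k`, so a round may be
charged the degree of its vertex. A round adds 2 steps for test and increment; the final 2 are the
initialization and the last test. -/
theorem WP.forV {i n : ℕ} {p : Program} {s : State} (E : ℕ → ℕ) (I : ℕ → State → Prop)
    (hi : i ∉ 0 :: p.regs) (h0p : 0 ∉ p.regs) (hn : s.reg 0 = n) (hE : E 0 = 0)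
    (h0 : I 0 (s.setReg i 0))
    (step : ∀ k < n, ∀ s', Frame (forV i p) s s' → s'.reg i = k → I k s' →
      WP p s' fun t s'' => E k + t + 2 ≤ E (k + 1) ∧ I (k + 1) (s''.setReg i (k + 1))) :
    WP (forV i p) s fun t s' => t ≤ E n + 2 ∧ I n s' := by
  simp only [List.mem_cons, not_or] at hi
  have hi0 : (0 : ℕ) ≠ i := Ne.symm hi.1
  have hsub : ∀ x ∈ (p ;; Program.instr (.inc i)).regs, x ∈ (MonophonicCover.forV i p).regs := by
    simp only [MonophonicCover.forV, Program.regs, Instr.regs, List.mem_append]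
    tauto
  have hsub' : ∀ x ∈ (p ;; Program.instr (.inc i)).arrs, x ∈ (MonophonicCover.forV i p).arrs := by
    simp [MonophonicCover.forV, Program.arrs, Instr.arrs]
  have hF0 : Frame (MonophonicCover.forV i p) s (s.setReg i 0) := by
    refine ⟨fun x hx => ?_, fun _ _ => rfl⟩
    rw [State.reg_setReg, if_neg]
    rintro rfl
    simp [MonophonicCover.forV, Program.regs, Instr.regs] at hx
  unfold MonophonicCover.forV
  rw [wp_seq, wp_instr]
  have := WP.loop (b := .lt i 0) (p := p ;; .instr (.inc i)) (s := s.setReg i 0)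
    (fun t s' => s'.reg 0 = n ∧ s'.reg i ≤ n ∧ t ≤ E (s'.reg i) ∧ I (s'.reg i) s')
    (fun s' => n - s'.reg i)
    (by simp [State.reg_setReg, hi0, hn, hE, h0])
    (by
      rintro t s' hF ⟨hn', hle, ht, hI⟩ hb
      simp only [Test.Holds, hn'] at hb
      have hF' := hF0.trans (hF.weaken hsub hsub')
      refine (step _ hb s' hF' rfl hI).seq ?_
      rintro t₁ s₁ hF₁ ⟨ht₁, hI₁⟩
      have e1 := hF₁.reg i hi.2
      have e2 := hF₁.reg 0 h0p
      rw [wp_instr]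
      simp only [Instr.exec, State.reg_setReg, e1, e2, hn', hi0, if_true, if_false]
      refine ⟨⟨trivial, by omega, by omega, hI₁⟩, by omega⟩)
  refine this.mono ?_
  rintro t s' - ⟨t₀, rfl, ⟨hn', hle, ht, hI⟩, hb⟩
  simp only [Test.Holds, hn', not_lt] at hb
  obtain rfl : s'.reg i = n := by omega
  exact ⟨by omega, hI⟩

/-! ### The input -/

/-- The number of array cells before the list of vertex `i`. -/
def adjOff {n : ℕ} (L : Fin n → List (Fin n)) (i : ℕ) : ℕ :=
  ((List.ofFn fun v => (L v).length).take i).sum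

theorem adjOff_zero {n : ℕ} (L : Fin n → List (Fin n)) : adjOff L 0 = 0 := by
  simp [adjOff]

theorem adjOff_succ {n : ℕ} (L : Fin n → List (Fin n)) (v : Fin n) :
    adjOff L (v + 1) = adjOff L v + (L v).length := by
  simp [adjOff, List.sum_take_succ]

theorem adjOff_last {n : ℕ} (L : Fin n → List (Fin n)) :
    adjOff L n = ∑ v, (L v).length := by
  simp [adjOff, List.take_of_length_le, List.sum_ofFn]

theorem getD_flatten {α : Type*} (d : α) (l : List (List α)) (i k : ℕ) (hi : i < l.length)
    (hk : k < l[i].length) : l.flatten.getD (((l.map List.length).take i).sum + k) d = l[i][k] := by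
  induction l generalizing i with
  | nil => simp at hi
  | cons a l ih =>
    cases i with
    | zero =>
      simp only [List.getElem_cons_zero] at hk
      simp [List.getElem?_append_left hk, hk]
    | succ i =>
      simp only [List.length_cons, Nat.add_lt_add_iff_right] at hi
      simp only [List.getElem_cons_succ] at hk ⊢
      have := ih i hi hk
      simp only [List.flatten_cons, List.map_cons, List.take_succ_cons, List.sum_cons]
      rw [List.getD_append_right _ _ _ _ (by omega), ← this]
      congr 1
      omega

theorem sum_length_eq {n : ℕ} {G : SimpleGraph (Fin n)} {L : Fin n → List (Fin n)}
    (hL : IsAdjacencyList G L) : ∑ v, (L v).length = 2 * G.edgeSet.ncard := by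
  classical
  have h1 : ∀ v, (L v).length = G.degree v := by
    intro v
    rw [← List.toFinset_card_of_nodup (hL v).1, ← SimpleGraph.card_neighborFinset_eq_degree]
    congr 1
    ext w
    simp [(hL v).2]
  rw [Finset.sum_congr rfl fun v _ => h1 v, SimpleGraph.sum_degrees_eq_twice_card_edges,
    ← SimpleGraph.coe_edgeFinset, Set.ncard_coe_finset]

/-- The state still holds the input. -/
def HasInput {n : ℕ} (L : Fin n → List (Fin n)) (s : State) : Prop :=
  s.reg 0 = n ∧ s.mem 0 = (inputState L).mem 0 ∧ s.mem 1 = (inputState L).mem 1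

theorem HasInput.off {n : ℕ} {L : Fin n → List (Fin n)} {s : State} (h : HasInput L s) {i : ℕ}
    (hi : i ≤ n) : s.mem 0 i = adjOff L i := by
  rw [h.2.1]
  simp [inputState, hi, adjOff]

theorem HasInput.target {n : ℕ} {L : Fin n → List (Fin n)} {s : State} (h : HasInput L s)
    (v : Fin n) (k : ℕ) (hk : k < (L v).length) : s.mem 1 (adjOff L v + k) = (L v)[k] := by
  rw [h.2.2]
  have := getD_flatten 0 ((List.ofFn L).map (List.map Fin.val)) v k (by simp) (by simpa using hk)
  simp only [List.getElem_map, List.getElem_ofFn] at this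
  rw [← this]
  simp [inputState, adjOff, List.map_flatten, List.map_ofFn, Function.comp_def]

theorem HasInput.of_frame {n : ℕ} {L : Fin n → List (Fin n)} {s s' : State} (h : HasInput L s)
    {p : Program} (hF : Frame p s s') (h0 : 0 ∉ p.regs := by decide)
    (h1 : 0 ∉ p.arrs := by decide) (h2 : 1 ∉ p.arrs := by decide) : HasInput L s' :=
  ⟨(hF.1 0 h0).trans h.1, (hF.2 0 h1).trans h.2.1, (hF.2 1 h2).trans h.2.2⟩

/-- For every neighbour of the vertex in register `u`, in the order of its list; register `10` holds
the neighbour. -/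
def forAdj (u : ℕ) (p : Program) : Program :=
  .instr (.load 8 0 u) ;; .instr (.copy 12 u) ;; .instr (.inc 12) ;; .instr (.load 9 0 12) ;;
    .loop (.lt 8 9) (.instr (.load 10 1 8) ;; p ;; .instr (.inc 8))

/-- Besides the body, an iteration costs the load of the neighbour, the increment and the test. The
constant 5 counts four instructions of preparation and the last test. -/
theorem WP.forAdj {n u : ℕ} {p : Program} {s : State} {L : Fin n → List (Fin n)}
    (hin : HasInput L s) (v : Fin n) (hu : s.reg u = v) (c : ℕ) (I : ℕ → State → Prop)
    (hu8 : u ≠ 8) (h8 : 8 ∉ p.regs) (h9 : 9 ∉ p.regs) (h0a : 0 ∉ p.arrs) (h1a : 1 ∉ p.arrs)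
    (h0 : I 0 (((s.setReg 8 (adjOff L v)).setReg 12 (v + 1)).setReg 9 (adjOff L (v + 1))))
    (step : ∀ (k : ℕ) (hk : k < (L v).length), ∀ s', Frame (forAdj u p) s s' → I k s' →
      WP p (s'.setReg 10 (L v)[k]) fun t s'' =>
        t ≤ c ∧ I (k + 1) (s''.setReg 8 (adjOff L v + (k + 1)))) :
    WP (forAdj u p) s fun t s' => t ≤ (c + 3) * (L v).length + 5 ∧ I (L v).length s' := by
  have hoff := hin.off (i := v) v.2.le
  have hoff' := hin.off (i := v + 1) v.2
  set s₀ := ((s.setReg 8 (adjOff L v)).setReg 12 (v + 1)).setReg 9 (adjOff L (v + 1)) with hs₀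
  have hF0 : Frame (MonophonicCover.forAdj u p) s s₀ := by
    refine ⟨fun x hx => ?_, fun _ _ => rfl⟩
    simp only [MonophonicCover.forAdj, Program.regs, Instr.regs, List.mem_append, List.mem_cons,
      List.not_mem_nil, or_false, not_or] at hx
    simp [hs₀, State.reg_setReg, hx]
  unfold MonophonicCover.forAdj
  have hss : ((((s.setReg 8 (adjOff L v)).setReg 12 v).setReg 12 (v + 1)).setReg 9
      (adjOff L (v + 1))) = s₀ := by
    rw [hs₀]
    ext x
    · simp only [State.reg_setReg]
      split_ifs <;> rfl
    · rfl
  simp only [wp_seq, wp_instr, Instr.exec, State.reg_setReg, State.mem_setReg, hu, hu8, if_false,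
    if_true, hoff, hoff', hss]
  have hlen := adjOff_succ L v
  set B : Program := .instr (.load 10 1 8) ;; p ;; .instr (.inc 8) with hB
  have := WP.loop (b := .lt 8 9) (p := B) (s := s₀)
    (fun t s' => s'.mem 0 = s.mem 0 ∧ s'.mem 1 = s.mem 1 ∧ s'.reg 9 = adjOff L (v + 1) ∧
      ∃ k, s'.reg 8 = adjOff L v + k ∧ k ≤ (L v).length ∧ t ≤ (c + 3) * k ∧ I k s')
    (fun s' => adjOff L (v + 1) - s'.reg 8)
    (by
      refine ⟨rfl, rfl, ?_, 0, ?_, Nat.zero_le _, Nat.zero_le _, h0⟩ <;>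
        simp [hs₀, State.reg_setReg])
    (by
      rintro t s' hF ⟨m0, m1, r9, k, r8, hk, ht, hI⟩ hb
      simp only [Test.Holds, r8, r9] at hb
      have hk' : k < (L v).length := by omega
      have hF' : Frame (MonophonicCover.forAdj u p) s s' := by
        refine hF0.trans (hF.weaken ?_ ?_)
        · simp only [hB, MonophonicCover.forAdj, Program.regs, Instr.regs, List.mem_append]
          tauto
        · simp only [hB, MonophonicCover.forAdj, Program.arrs, Instr.arrs, List.mem_append]
          tauto
      -- The invariant retains the input arrays but not register `0`. Restoring `n` there does not
      -- affect the arrays and gives access to `HasInput.target`.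
      have hin' : HasInput L (s'.setReg 0 n) :=
        ⟨by simp [State.reg_setReg], m0.trans hin.2.1, m1.trans hin.2.2⟩
      have htgt : s'.mem 1 (adjOff L v + k) = (L v)[k] := hin'.target v k hk'
      rw [hB, wp_seq, wp_instr]
      simp only [Instr.exec, r8, htgt]
      refine (step k hk' s' hF' hI).seq ?_
      rintro t₁ s₁ hF₁ ⟨ht₁, hI₁⟩
      have e8 := hF₁.reg 8 h8
      have e9 := hF₁.reg 9 h9
      have e0 := hF₁.mem 0 h0a
      have e1 := hF₁.mem 1 h1a
      simp only [State.reg_setReg, State.mem_setReg, r8, r9, m0, m1] at e8 e9 e0 e1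
      norm_num at e8 e9
      rw [wp_instr]
      simp only [Instr.exec, State.reg_setReg, State.mem_setReg, e8, e0, e1]
      refine ⟨⟨trivial, trivial, by simpa using e9, k + 1, by simp [Nat.add_assoc], hk', ?_, ?_⟩, ?_⟩
      · rw [Nat.mul_succ]; omega
      · rw [Nat.add_assoc]; exact hI₁
      · simp; omega)
  refine this.mono ?_
  rintro t s' - ⟨t₀, rfl, ⟨-, -, r9, k, r8, hk, ht, hI⟩, hb⟩
  simp only [Test.Holds, r8, r9, not_lt] at hb
  obtain rfl : k = (L v).length := by omega
  exact ⟨by omega, hI⟩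

/-! ### Searching a component

Registers `3`, `4`, `5`, `6` hold the constants `0`, `1`, `2`, `3`. Array `4` holds a colour for every
vertex: `0` for a free vertex, `1` for a vertex reached or to be ignored, `2` for a blocked vertex, `3`
for a blocked vertex adjacent to a reached one. Array `5` is the queue. -/

/-- Registers `3`, `4`, `5`, `6` hold their constants. -/
def HasConsts (s : State) : Prop :=
  s.reg 3 = 0 ∧ s.reg 4 = 1 ∧ s.reg 5 = 2 ∧ s.reg 6 = 3

theorem HasConsts.of_frame {s s' : State} (h : HasConsts s) {p : Program} (hF : Frame p s s')
    (h3 : 3 ∉ p.regs := by decide) (h4 : 4 ∉ p.regs := by decide)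
    (h5 : 5 ∉ p.regs := by decide) (h6 : 6 ∉ p.regs := by decide) : HasConsts s' := by
  refine ⟨(hF.1 3 h3).trans h.1, (hF.1 4 h4).trans h.2.1, (hF.1 5 h5).trans h.2.2.1,
    (hF.1 6 h6).trans h.2.2.2⟩

/-- Treat the neighbour in register `10` of a reached vertex. -/
def floodStep : Program :=
  .instr (.load 11 4 10) ;;
  .ite (.eq 11 3) (.instr (.store 4 10 4) ;; .instr (.store 5 15 10) ;; .instr (.inc 15))
    (.ite (.eq 11 5) (.instr (.store 4 10 6)) .skip)

/-- Search from the vertex in register `16`. -/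
def flood : Program :=
  .instr (.const 14 0) ;; .instr (.const 15 1) ;; .instr (.store 5 14 16) ;;
  .instr (.store 4 16 4) ;;
  .loop (.lt 14 15) (.instr (.load 13 5 14) ;; .instr (.inc 14) ;; forAdj 13 floodStep)

section Flood

variable {n : ℕ} {G : SimpleGraph (Fin n)} {L : Fin n → List (Fin n)}

/-- The invariant of the search: `q` lists the reached vertices, and the pairs in `P` have been
treated. -/
structure FloodInv (G : SimpleGraph (Fin n)) (c : Fin n → ℕ) (v : Fin n) (q : List (Fin n))
    (P : Fin n → Fin n → Prop) (tail : ℕ) (queue col : ℕ → ℕ) : Prop where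
  tail_eq : tail = q.length
  queue_eq : ∀ i (hi : i < q.length), queue i = q[i]
  nodup : q.Nodup
  start_mem : v ∈ q
  reach : ∀ w ∈ q, ReachIn G {x | c x = 0} v w
  col_reached : ∀ w ∈ q, col w = 1
  col_blocked : ∀ w ∉ q, c w = 2 → col w = 2 ∨ (col w = 3 ∧ ∃ u ∈ q, G.Adj u w)
  col_other : ∀ w ∉ q, c w ≠ 2 → col w = c w
  treated : ∀ u w, P u w → (c w = 0 → w ∈ q) ∧ (c w = 2 → col w = 3)

theorem FloodInv.mono {c : Fin n → ℕ} {v : Fin n} {q : List (Fin n)} {P P' : Fin n → Fin n → Prop}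
    {tail : ℕ} {queue col : ℕ → ℕ} (h : FloodInv G c v q P tail queue col)
    (hP : ∀ u w, P' u w → P u w) : FloodInv G c v q P' tail queue col :=
  { h with treated := fun u w hu => h.treated u w (hP u w hu) }

/-- All reached vertices other than the start had colour `0`, and the start is not blocked. -/
theorem FloodInv.notMem {c : Fin n → ℕ} {v : Fin n} {q : List (Fin n)} {P : Fin n → Fin n → Prop}
    {tail : ℕ} {queue col : ℕ → ℕ} (h : FloodInv G c v q P tail queue col) (hv : c v ≠ 2)
    {w : Fin n} (hw : c w = 2) : w ∉ q := by
  intro hq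
  by_cases hwv : w = v
  · exact hv (hwv ▸ hw)
  · have : c w = 0 := (h.reach w hq).mem_of_ne hwv
    omega

theorem wp_floodStep {s : State} (hc : HasConsts s) {c : Fin n → ℕ} {v : Fin n} (hv : c v ≠ 2)
    {q : List (Fin n)} {P : Fin n → Fin n → Prop}
    (h : FloodInv G c v q P (s.reg 15) (s.mem 5) (s.mem 4)) {u w : Fin n} (hu : u ∈ q)
    (huw : G.Adj u w) (hw : s.reg 10 = w) :
    WP floodStep s fun t s' => t ≤ 5 ∧ ∃ q', q <+: q' ∧
      FloodInv G c v q' (fun a b => P a b ∨ (a = u ∧ b = w)) (s'.reg 15) (s'.mem 5) (s'.mem 4) := by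
  obtain ⟨h3, h4, h5, h6⟩ := hc
  unfold floodStep
  simp only [wp_seq, wp_instr, wp_ite, wp_skip, Instr.exec, Test.Holds, State.reg_setReg,
    State.mem_setReg, State.reg_setMem, h3, h4, h5, h6, hw, if_true, Nat.reduceEqDiff,
    if_false]
  refine ⟨fun h0 => ⟨by norm_num, q ++ [w], List.prefix_append _ _, ?_⟩, fun h0 =>
    ⟨fun h2 => ⟨by norm_num, q, List.prefix_rfl, ?_⟩, fun h2 => ⟨by norm_num, q, List.prefix_rfl, ?_⟩⟩⟩
  · have hwq : w ∉ q := fun hq => by have := h.col_reached w hq; omega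
    have hw2 : c w ≠ 2 := fun h2 => by rcases h.col_blocked w hwq h2 with h | h <;> omega
    have hw0 : c w = 0 := by rw [← h.col_other w hwq hw2, h0]
    have e1 : ∀ x : Fin n, (State.setMem (State.setMem (s.setReg 11 (s.mem 4 w)) 4 w 1) 5 (s.reg 15) w).mem 4 x
        = if x = w then 1 else s.mem 4 x := by
      intro x
      simp [State.mem_setMem, State.mem_setReg, Fin.val_inj]
    constructor
    · simp [h.tail_eq]
    · intro i hi
      simp only [List.length_append, List.length_singleton] at hi
      simp only [State.mem_setMem, State.mem_setReg, h.tail_eq]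
      by_cases hi' : i = q.length
      · subst hi'; simp
      · have : i < q.length := by omega
        simp [hi', List.getElem_append_left this, h.queue_eq i this]
    · simpa [List.nodup_append, h.nodup] using fun a ha (e : a = w) => hwq (e ▸ ha)
    · simp [h.start_mem]
    · intro x hx
      simp only [List.mem_append, List.mem_singleton] at hx
      rcases hx with hx | rfl
      · exact h.reach x hx
      · exact (h.reach u hu).trans (.of_adj huw hw0)
    · intro x hx
      rw [e1]
      split_ifs with hxw
      · rfl
      · exact h.col_reached x (by simpa [hxw] using hx)
    · intro x hx hx2
      simp only [List.mem_append, List.mem_singleton, not_or] at hx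
      rw [e1, if_neg hx.2]
      refine (h.col_blocked x hx.1 hx2).imp id fun ⟨h, u, hu, hux⟩ => ⟨h, u, ?_, hux⟩
      simp [hu]
    · intro x hx hx2
      simp only [List.mem_append, List.mem_singleton, not_or] at hx
      rw [e1, if_neg hx.2]
      exact h.col_other x hx.1 hx2
    · rintro a b (hab | ⟨rfl, rfl⟩)
      · refine ⟨fun hb => by simp [(h.treated a b hab).1 hb], fun hb => ?_⟩
        rw [e1, if_neg (by rintro rfl; exact hw2 hb)]
        exact (h.treated a b hab).2 hb
      · exact ⟨fun _ => by simp, fun hb => absurd hb hw2⟩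
  · have hwq : w ∉ q := fun hq => by have := h.col_reached w hq; omega
    have hw2 : c w = 2 := by
      by_contra h2'
      have := h.col_other w hwq h2'
      omega
    have e1 : ∀ x : Fin n, (State.setMem (s.setReg 11 (s.mem 4 w)) 4 w 3).mem 4 x
        = if x = w then 3 else s.mem 4 x := by
      intro x
      simp [State.mem_setMem, State.mem_setReg, Fin.val_inj]
    rw [State.mem_setMem_ne _ _ _ _ _ (by decide), State.mem_setReg]
    refine { h with col_reached := ?_, col_blocked := ?_, col_other := ?_, treated := ?_ }
    · intro x hx
      rw [e1, if_neg (by rintro rfl; exact hwq hx)]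
      exact h.col_reached x hx
    · intro x hx hx2
      rw [e1]
      split_ifs with hxw
      · exact .inr ⟨rfl, u, hu, hxw ▸ huw⟩
      · exact h.col_blocked x hx hx2
    · intro x hx hx2
      rw [e1, if_neg (by rintro rfl; exact hx2 hw2)]
      exact h.col_other x hx hx2
    · rintro a b (hab | ⟨rfl, rfl⟩)
      · refine ⟨(h.treated a b hab).1, fun hb => ?_⟩
        rw [e1]
        split_ifs with hbw
        · rfl
        · exact (h.treated a b hab).2 hb
      · exact ⟨fun hb => by omega, fun _ => by simp [e1]⟩
  -- The current colour is neither `0` nor `2`: a free `w` must already be in the queue, and a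
  -- blocked one must already have colour `3`.
  · refine { h with treated := ?_ }
    rintro a b (hab | ⟨rfl, rfl⟩)
    · exact h.treated a b hab
    · refine ⟨fun hb => ?_, fun hb => ?_⟩
      · by_contra hbq
        exact h0 ((h.col_other b hbq (by omega)).trans hb)
      · have hbq := h.notMem hv hb
        exact ((h.col_blocked b hbq hb).resolve_left h2).1

/-- A vertex enters the queue only once, so all scans of adjacency lists together cost at most the
sum of the degrees. -/
theorem sum_take_length_le {q : List (Fin n)} (hq : q.Nodup) :
    (q.map fun v => (L v).length).sum ≤ adjOff L n := by
  rw [adjOff_last, ← List.sum_toFinset _ hq]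
  exact Finset.sum_le_sum_of_subset (Finset.subset_univ _)

/-- The start may have colour `0` or `1`: a round of the search starts at a free vertex, while
`pickReached` starts at an attached vertex outside the component. -/
theorem wp_flood (hL : IsAdjacencyList G L) {s : State} (hin : HasInput L s) (hc : HasConsts s)
    {c : Fin n → ℕ} (hcol : ∀ w : Fin n, s.mem 4 w = c w)
    {v : Fin n} (hv : s.reg 16 = v) (hv2 : c v ≠ 2) :
    WP flood s fun t s' => t ≤ 8 * n + 8 * adjOff L n + 5 ∧
      ∀ w : Fin n, (ReachIn G {x | c x = 0} v w → s'.mem 4 w = 1) ∧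
        (¬ ReachIn G {x | c x = 0} v w → (c w ≠ 2 → s'.mem 4 w = c w) ∧ (c w = 2 →
          (s'.mem 4 w = 3 ∧ ∃ u, ReachIn G {x | c x = 0} v u ∧ G.Adj u w) ∨
          (s'.mem 4 w = 2 ∧ ¬ ∃ u, ReachIn G {x | c x = 0} v u ∧ G.Adj u w))) := by
  unfold flood
  obtain ⟨h3, h4, h5, h6⟩ := id hc
  simp only [wp_seq, wp_instr, Instr.exec, State.reg_setReg, State.reg_setMem,
    h4, hv, if_true, Nat.reduceEqDiff, if_false]
  set s₀ := (((s.setReg 14 0).setReg 15 1).setMem 5 0 v).setMem 4 v 1 with hs₀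
  have hin₀ : HasInput L s₀ := hin
  have hc₀ : HasConsts s₀ := hc
  refine (WP.loop (fun t s' => ∃ q h, s'.reg 14 = h ∧ h ≤ q.length ∧
      t ≤ 8 * h + 8 * ((q.take h).map fun v => (L v).length).sum ∧
      FloodInv G c v q (fun a b => a ∈ q.take h ∧ G.Adj a b) (s'.reg 15) (s'.mem 5) (s'.mem 4))
    (fun s' => n - s'.reg 14) ?_ ?_).mono ?_
  · refine ⟨[v], 0, by simp [hs₀, State.reg_setReg, State.reg_setMem], by simp, by simp, ?_⟩
    have e1 : ∀ x : Fin n, s₀.mem 4 x = if x = v then 1 else c x := by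
      intro x
      simp [hs₀, State.mem_setMem, State.mem_setReg, Fin.val_inj, hcol]
    constructor
    · simp [hs₀, State.reg_setReg, State.reg_setMem]
    · intro i hi
      simp only [List.length_singleton, Nat.lt_one_iff] at hi
      subst hi
      simp [hs₀, State.mem_setMem]
    · simp
    · simp
    · rintro w hw
      rw [List.mem_singleton] at hw
      subst hw
      exact .refl
    · intro w hw
      simp [e1, List.mem_singleton.1 hw]
    · intro w hw hw2
      rw [List.mem_singleton] at hw
      exact .inl (by rw [e1, if_neg hw, hw2])
    · intro w hw hw2
      rw [List.mem_singleton] at hw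
      rw [e1, if_neg hw]
    · simp
  · rintro t s' hF ⟨q, h, hh, hle, ht, hI⟩ hb
    simp only [Test.Holds, hh, hI.tail_eq] at hb
    set u := q[h] with hu
    have huq : u ∈ q := List.getElem_mem hb
    have hlen : q.length ≤ n := by simpa using hI.nodup.length_le_card
    have hin' : HasInput L s' := hin₀.of_frame hF
    have hc' : HasConsts s' := hc₀.of_frame hF
    have hq := hI.queue_eq h hb
    rw [wp_seq, wp_instr, wp_seq, wp_instr]
    simp only [Instr.exec, State.reg_setReg, hh, hq, Nat.reduceEqDiff, if_false]
    have hFa := WP.forAdj (u := 13) (p := floodStep) (L := L)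
      (s := (s'.setReg 13 u).setReg 14 (h + 1))
      ⟨hin'.1, hin'.2.1, hin'.2.2⟩ u (by simp [State.reg_setReg]) 5
      (fun k s'' => ∃ q', q <+: q' ∧ FloodInv G c v q'
        (fun a b => (a ∈ q.take h ∧ G.Adj a b) ∨ (a = u ∧ b ∈ (L u).take k))
        (s''.reg 15) (s''.mem 5) (s''.mem 4))
      (by decide) (by decide) (by decide) (by decide) (by decide)
      (by
        refine ⟨q, List.prefix_rfl, ?_⟩
        simp only [State.reg_setReg, State.mem_setReg, Nat.reduceEqDiff, if_false]
        exact hI.mono (by simp))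
      (by
        rintro k hk s₁ hF₁ ⟨q', hqq', hI'⟩
        have hc₁ : HasConsts s₁ := HasConsts.of_frame (s := (s'.setReg 13 u).setReg 14 (h + 1)) hc' hF₁
        have hadj : G.Adj u (L u)[k] := ((hL u).2 _).1 (List.getElem_mem hk)
        refine (wp_floodStep (s := s₁.setReg 10 (L u)[k]) hc₁ hv2 hI' (hqq'.subset huq) hadj
          (by simp [State.reg_setReg])).mono ?_
        rintro t₂ s₂ - ⟨ht₂, q₂, hq₂, hI₂⟩
        refine ⟨ht₂, q₂, hqq'.trans hq₂, ?_⟩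
        simp only [State.reg_setReg, State.mem_setReg, Nat.reduceEqDiff, if_false]
        refine hI₂.mono ?_
        rintro a b (hab | ⟨rfl, hb⟩)
        · exact .inl (.inl hab)
        · rw [List.take_succ_eq_append_getElem hk, List.mem_append, List.mem_singleton] at hb
          exact hb.elim (fun hb => .inl (.inr ⟨rfl, hb⟩)) fun hb => .inr ⟨rfl, hb⟩)
    refine hFa.mono ?_
    rintro t₁ s₁ hF₁ ⟨ht₁, q', hqq', hI'⟩
    have e14 : s₁.reg 14 = h + 1 := by
      rw [hF₁.reg 14]; simp [State.reg_setReg]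
    have hq'h : q'.take (h + 1) = q.take h ++ [u] := by
      obtain ⟨r, rfl⟩ := hqq'
      rw [List.take_append_of_le_length (by omega), List.take_succ_eq_append_getElem hb]
    have hlen' := hqq'.length_le
    refine ⟨⟨q', h + 1, e14, by omega, ?_, hI'.mono ?_⟩, by omega⟩
    · rw [hq'h, List.map_append, List.sum_append]
      simp only [List.map_singleton, List.sum_singleton]
      omega
    · rintro a b ⟨ha, hab⟩
      rw [hq'h, List.mem_append, List.mem_singleton] at ha
      rcases ha with ha | rfl
      · exact .inl ⟨ha, hab⟩
      · refine .inr ⟨rfl, ?_⟩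
        rw [List.take_length]
        exact ((hL _).2 b).2 hab
  · rintro t s' - ⟨t₀, rfl, ⟨q, h, hh, hle, ht, hI⟩, hb⟩
    simp only [Test.Holds, hh, hI.tail_eq, not_lt] at hb
    have hlen : q.length ≤ n := by simpa using hI.nodup.length_le_card
    obtain rfl : h = q.length := by omega
    rw [List.take_length] at ht hI
    have hsum := sum_take_length_le (L := L) hI.nodup
    refine ⟨by omega, fun w => ?_⟩
    have hmem : ∀ w, ReachIn G {x | c x = 0} v w → w ∈ q := by
      intro w hw
      induction hw with
      | refl => exact hI.start_mem
      | tail _ h ih => exact (hI.treated _ _ ⟨ih, h.1⟩).1 h.2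
    refine ⟨fun hw => hI.col_reached w (hmem w hw), fun hw => ?_⟩
    have hwq : w ∉ q := fun hq => hw (hI.reach w hq)
    refine ⟨hI.col_other w hwq, fun hw2 => ?_⟩
    by_cases hex : ∃ u, ReachIn G {x | c x = 0} v u ∧ G.Adj u w
    · obtain ⟨u, hu, huw⟩ := hex
      exact .inl ⟨(hI.treated u w ⟨hmem u hu, huw⟩).2 hw2, u, hu, huw⟩
    · refine .inr ⟨(hI.col_blocked w hwq hw2).resolve_right ?_, hex⟩
      rintro ⟨-, u, hu, huw⟩
      exact hex ⟨u, hI.reach u hu, huw⟩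

end Flood

/-! ### Simple loops over the vertices -/

section VertexLoops

variable {n : ℕ}

theorem WP.map {p : Program} {s : State} (hn : s.reg 0 = n) (b : ℕ) (g : Fin n → ℕ) (c : ℕ)
    (h7 : 7 ∉ 0 :: p.regs) (h0 : 0 ∉ p.regs)
    (step : ∀ v : Fin n, ∀ s', Frame (MonophonicCover.forV 7 p) s s' → s'.reg 7 = v →
      (∀ w : Fin n, v ≤ w → s'.mem b w = s.mem b w) →
      WP p s' fun t s'' => t ≤ c ∧ ∀ j, s''.mem b j = if j = v then g v else s'.mem b j) :
    WP (MonophonicCover.forV 7 p) s fun t s' => t ≤ (c + 2) * n + 2 ∧ ∀ v : Fin n, s'.mem b v = g v := by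
  refine (WP.forV (n := n) (fun k => (c + 2) * k)
    (fun k s' => ∀ v : Fin n, s'.mem b v = if v < k then g v else s.mem b v) h7 h0 hn rfl
    (by simp [State.mem_setReg]) ?_).mono ?_
  · intro k hk s' hF h7' hI
    refine (step ⟨k, hk⟩ s' hF h7' fun w hw => ?_).mono ?_
    · rw [hI, if_neg]
      exact not_lt.2 hw
    · rintro t s'' - ⟨ht, hs⟩
      refine ⟨by rw [Nat.mul_succ]; omega, fun v => ?_⟩
      rw [State.mem_setReg, hs, hI]
      by_cases hv : (v : ℕ) = k
      · obtain rfl : v = ⟨k, hk⟩ := Fin.ext hv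
        simp
      · rw [if_neg hv]
        congr 1
        exact propext ⟨by omega, by omega⟩
  · rintro t s' - ⟨ht, hI⟩
    exact ⟨ht, fun v => by rw [hI, if_pos v.2]⟩

/-- For every vertex `v`, write into `b[v]` register `x` or `y` according to whether `a[v]` equals
register `k`. -/
def mapIf (a k b x y : ℕ) : Program :=
  forV 7 (.instr (.load 11 a 7) ;; .ite (.eq 11 k) (.instr (.store b 7 x)) (.instr (.store b 7 y)))

theorem wp_mapIf {s : State} (hn : s.reg 0 = n) {a k b x y : ℕ} (hab : a ≠ b)
    (hk : k ≠ 7 ∧ k ≠ 11) (hx : x ≠ 7 ∧ x ≠ 11) (hy : y ≠ 7 ∧ y ≠ 11) :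
    WP (mapIf a k b x y) s fun t s' => t ≤ 5 * n + 2 ∧
      ∀ v : Fin n, s'.mem b v = if s.mem a v = s.reg k then s.reg x else s.reg y := by
  refine WP.map hn b _ 3 (by simp [Program.regs, Instr.regs]) (by simp [Program.regs, Instr.regs]) ?_
  intro v s' hF h7 _
  have hr : ∀ z, z ≠ 7 ∧ z ≠ 11 → s'.reg z = s.reg z := fun z hz => hF.1 z (by
    simp [MonophonicCover.forV, Program.regs, Instr.regs, hz])
  have ha : s'.mem a = s.mem a := hF.2 a (by
    simp [MonophonicCover.forV, Program.arrs, Instr.arrs, hab])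
  simp only [wp_seq, wp_instr, wp_ite, Instr.exec, Test.Holds, State.reg_setReg, h7, if_true, hk,
    hx, hy, if_false, hr k hk, hr x hx, hr y hy, ha, State.mem_setMem, State.mem_setReg, true_and,
    Nat.reduceEqDiff]
  constructor <;> intro h <;> simp [h]

/-- Find a vertex `v` for which `a[v]` equals register `k`, and write it into register `r`. -/
def findEq (r a k : ℕ) : Program :=
  forV 7 (.instr (.load 11 a 7) ;; .ite (.eq 11 k) (.instr (.copy r 7)) .skip)

/-- That the register keeps its value when nothing is found matters in `pickVertex`, where a second
search overrides a first one only on success. -/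
theorem wp_findEq {s : State} (hn : s.reg 0 = n) {r a k : ℕ} (hr : r ≠ 0 ∧ r ≠ 7 ∧ r ≠ 11)
    (hk : k ≠ 7 ∧ k ≠ 11 ∧ k ≠ r) :
    WP (findEq r a k) s fun t s' => t ≤ 5 * n + 2 ∧
      (((∀ v : Fin n, s.mem a v ≠ s.reg k) ∧ s'.reg r = s.reg r) ∨
        ∃ v : Fin n, s.mem a v = s.reg k ∧ s'.reg r = v) := by
  refine (WP.forV (n := n) (fun k => 5 * k)
    (fun i s' => ((∀ v : Fin n, v < i → s.mem a v ≠ s.reg k) ∧ s'.reg r = s.reg r) ∨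
      ∃ v : Fin n, s.mem a v = s.reg k ∧ s'.reg r = v)
    (by simp [Program.regs, Instr.regs, hr.2.1.symm]) (by simp [Program.regs, Instr.regs, hr.1.symm]) hn rfl
    (by simp [State.reg_setReg, hr.2.1]) ?_).mono ?_
  · intro i hi s' hF h7 hI
    have hk' : s'.reg k = s.reg k := hF.1 k (by
      simp [MonophonicCover.forV, Program.regs, Instr.regs, hk])
    have ha : s'.mem a = s.mem a := hF.2 a (by
      simp [MonophonicCover.forV, Program.arrs, Instr.arrs])
    simp only [wp_seq, wp_instr, wp_ite, wp_skip, Instr.exec, Test.Holds, State.reg_setReg, h7,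
      if_true, hk, if_false, hk', ha, hr, Nat.reduceEqDiff]
    constructor <;> intro h
    · exact ⟨by omega, .inr ⟨⟨i, hi⟩, h, rfl⟩⟩
    · refine ⟨by omega, hI.imp (fun ⟨h1, h2⟩ => ⟨fun v hv => ?_, h2⟩) id⟩
      by_cases hvi : (v : ℕ) = i
      · rw [hvi]; exact h
      · exact h1 v (by omega)
  · rintro t s' - ⟨ht, hI⟩
    exact ⟨ht, hI.imp (fun ⟨h1, h2⟩ => ⟨fun v => h1 v v.2, h2⟩) id⟩

/-- Count the vertices of colour `3` in register `22`. -/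
def countAttached : Program :=
  .instr (.const 22 0) ;;
    forV 7 (.instr (.load 11 4 7) ;; .ite (.eq 11 6) (.instr (.inc 22)) .skip)

theorem wp_countAttached {s : State} (hn : s.reg 0 = n) (h6 : s.reg 6 = 3) :
    WP countAttached s fun t s' => t ≤ 5 * n + 3 ∧
      s'.reg 22 = (Finset.univ.filter fun v : Fin n => s.mem 4 v = 3).card := by
  unfold countAttached
  rw [wp_seq, wp_instr]
  refine (WP.forV (n := n) (fun k => 5 * k)
    (fun i s' => s'.reg 22 = (Finset.univ.filter fun v : Fin n => v < i ∧ s.mem 4 v = 3).card)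
    (by decide) (by decide) (by simpa [Instr.exec, State.reg_setReg] using hn) rfl
    (by simp [State.reg_setReg, Instr.exec]) ?_).mono ?_
  · intro i hi s' hF h7 hI
    have h6' : s'.reg 6 = 3 := (hF.reg 6).trans h6
    have h4 : s'.mem 4 = s.mem 4 := hF.mem 4
    simp only [wp_seq, wp_instr, wp_ite, wp_skip, Instr.exec, Test.Holds, State.reg_setReg, h7,
      if_true, if_false, h6', h4, Nat.reduceEqDiff, hI]
    constructor <;> intro h
    · refine ⟨by omega, ?_⟩
      have : (Finset.univ.filter fun v : Fin n => v < i + 1 ∧ s.mem 4 v = 3) =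
          insert ⟨i, hi⟩ (Finset.univ.filter fun v : Fin n => v < i ∧ s.mem 4 v = 3) := by
        ext v
        simp only [Finset.mem_filter, Finset.mem_univ, true_and, Finset.mem_insert, Fin.ext_iff]
        constructor
        · rintro ⟨h1, h2⟩
          by_cases hv : (v : ℕ) = i
          · exact .inl hv
          · exact .inr ⟨by omega, h2⟩
        · rintro (h1 | ⟨h1, h2⟩)
          · exact ⟨by omega, h1 ▸ h⟩
          · exact ⟨by omega, h2⟩
      rw [this, Finset.card_insert_of_notMem (by simp)]
    · refine ⟨by omega, ?_⟩
      congr 1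
      ext v
      simp only [Finset.mem_filter, Finset.mem_univ, true_and]
      refine and_congr_left fun h2 => ?_
      have : (v : ℕ) ≠ i := fun hv => h (hv ▸ h2)
      omega
  · rintro t s' - ⟨ht, hI⟩
    refine ⟨by omega, ?_⟩
    rw [hI]
    simp

end VertexLoops

/-! ### Testing for a clique separator -/

/-- Register `24` tells whether the vertices of colour `3` form a clique, and register `25` whether
there is a vertex of a colour other than `1` and `3`. -/
def cliqueCheck : Program :=
  .instr (.const 24 1) ;; .instr (.const 25 0) ;;
    forV 7 (.instr (.load 11 4 7) ;; .ite (.eq 11 6)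
      (.instr (.const 23 1) ;;
        forAdj 7 (.instr (.load 26 4 10) ;; .ite (.eq 26 6) (.instr (.inc 23)) .skip) ;;
        .ite (.eq 23 22) .skip (.instr (.const 24 0)))
      (.ite (.eq 11 4) .skip (.instr (.const 25 1))))

section CliqueCheck

variable {n : ℕ} {G : SimpleGraph (Fin n)} {L : Fin n → List (Fin n)}

/-- The neighbours of `v` satisfying `P` form a subset of the vertices other than `v` satisfying
`P`; equal cardinality means equality. This tests for a clique by counting, in time proportional to
the degrees. -/
theorem card_eq_iff_adj (hL : IsAdjacencyList G L) (P : Fin n → Prop) [DecidablePred P] {v : Fin n}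
    (hv : P v) :
    1 + (L v).countP (fun w => P w) = (Finset.univ.filter P).card ↔
      ∀ w, P w → v ≠ w → G.Adj v w := by
  have h1 : (L v).countP (fun w => P w) = ((L v).toFinset.filter P).card := by
    rw [List.countP_eq_length_filter, ← List.toFinset_card_of_nodup ((hL v).1.filter _),
      List.toFinset_filter]
    simp
  have h2 : (Finset.univ.filter P).card = 1 + ((Finset.univ.filter P).erase v).card := by
    rw [Finset.card_erase_of_mem (by simpa using hv)]
    have : 0 < (Finset.univ.filter P).card := Finset.card_pos.2 ⟨v, by simpa using hv⟩
    omega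
  have hsub : (L v).toFinset.filter P ⊆ (Finset.univ.filter P).erase v := by
    intro w
    simp only [Finset.mem_filter, List.mem_toFinset, (hL v).2, Finset.mem_erase, Finset.mem_univ,
      true_and]
    exact fun ⟨h, h'⟩ => ⟨h.ne', h'⟩
  rw [h1, h2, Nat.add_left_cancel_iff]
  constructor
  · intro h w hw hvw
    have := Finset.eq_of_subset_of_card_le hsub h.ge
    have hw' : w ∈ (Finset.univ.filter P).erase v := by simp [hw, hvw.symm]
    rw [← this] at hw'
    simpa [(hL v).2, hw] using hw'
  · intro h
    congr 1
    refine hsub.antisymm fun w hw => ?_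
    simp only [Finset.mem_filter, Finset.mem_erase, Finset.mem_univ, true_and] at hw
    simp [(hL v).2, hw.2, h w hw.2 hw.1.symm]

theorem wp_cliqueCheck (hL : IsAdjacencyList G L) {s : State} (hin : HasInput L s)
    (hc : HasConsts s)
    (h22 : s.reg 22 = (Finset.univ.filter fun v : Fin n => s.mem 4 v = 3).card) :
    WP cliqueCheck s fun t s' => t ≤ 14 * n + 8 * adjOff L n + 4 ∧
      (s'.reg 24 = 1 ↔ G.IsClique {v | s.mem 4 v = 3}) ∧
      (s'.reg 25 = 1 ↔ ∃ v : Fin n, s.mem 4 v ≠ 1 ∧ s.mem 4 v ≠ 3) := by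
  unfold cliqueCheck
  simp only [wp_seq, wp_instr]
  refine (WP.forV (n := n) (fun k => 14 * k + 8 * adjOff L k)
    (fun i s' =>
      (s'.reg 24 = 1 ↔ ∀ v w : Fin n, v < i → s.mem 4 v = 3 → s.mem 4 w = 3 → v ≠ w → G.Adj v w) ∧
      (s'.reg 25 = 1 ↔ ∃ v : Fin n, v < i ∧ s.mem 4 v ≠ 1 ∧ s.mem 4 v ≠ 3))
    (by decide) (by decide) (by simpa [Instr.exec, State.reg_setReg] using hin.1)
    (by simp [adjOff_zero]) (by simp [State.reg_setReg, Instr.exec]) ?_).mono ?_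
  · intro i hi s' hF h7 ⟨hI, hI'⟩
    have hin' : HasInput L s' :=
      HasInput.of_frame (s := ((Instr.const 25 0).exec ((Instr.const 24 1).exec s))) hin hF
    have hc' : HasConsts s' :=
      HasConsts.of_frame (s := ((Instr.const 25 0).exec ((Instr.const 24 1).exec s))) hc hF
    have e22 : s'.reg 22 = (Finset.univ.filter fun v : Fin n => s.mem 4 v = 3).card :=
      (hF.reg 22).trans h22
    have e4 : s'.mem 4 = s.mem 4 := hF.mem 4
    have hoff := adjOff_succ L ⟨i, hi⟩
    simp only at hoff
    have hsplit : ∀ v : Fin n, (v : ℕ) < i + 1 ↔ v = ⟨i, hi⟩ ∨ (v : ℕ) < i := by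
      intro v; rw [Fin.ext_iff]; simp only; omega
    simp only [wp_seq, wp_instr, wp_ite, wp_skip, Instr.exec, Test.Holds, State.reg_setReg, h7,
      if_true, if_false, hc'.2.2.2, hc'.2.1, e4, Nat.reduceEqDiff]
    refine ⟨fun h3 => ?_, fun h3 => ⟨fun h1 => ⟨by omega, ?_, ?_⟩, fun h1 => ⟨by omega, ?_, ?_⟩⟩⟩
    · refine (WP.forAdj (L := L) (s := (s'.setReg 11 (s.mem 4 i)).setReg 23 1) hin' ⟨i, hi⟩
        (by simpa [State.reg_setReg] using h7) 3
        (fun k s'' => s''.reg 23 =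
          1 + ((L ⟨i, hi⟩).take k).countP (fun w : Fin n => s.mem 4 w = 3))
        (by decide) (by decide) (by decide) (by decide) (by decide) (by simp [State.reg_setReg])
        ?_).mono ?_
      · intro k hk s₁ hF₁ hk₁
        have f6 : s₁.reg 6 = 3 := by
          rw [hF₁.reg 6]; simpa [State.reg_setReg] using hc'.2.2.2
        have f4 : s₁.mem 4 = s.mem 4 := (hF₁.mem 4).trans e4
        simp only [wp_seq, wp_instr, wp_ite, wp_skip, Instr.exec, Test.Holds, State.reg_setReg,
          State.mem_setReg, if_true, if_false, f4, f6, Nat.reduceEqDiff, hk₁,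
          List.take_succ_eq_append_getElem hk, List.countP_append]
        constructor <;> intro h <;> simp [h]
        omega
      · rintro t₁ s₁ hF₁ ⟨ht₁, hcnt⟩
        rw [List.take_length] at hcnt
        have f22 : s₁.reg 22 = (Finset.univ.filter fun v : Fin n => s.mem 4 v = 3).card := by
          rw [hF₁.reg 22]; simpa [State.reg_setReg] using e22
        have f24 : s₁.reg 24 = s'.reg 24 := by
          rw [hF₁.reg 24]; simp [State.reg_setReg]
        have f25 : s₁.reg 25 = s'.reg 25 := by
          rw [hF₁.reg 25]; simp [State.reg_setReg]
        have hiff := card_eq_iff_adj hL (fun w : Fin n => s.mem 4 w = 3) (v := ⟨i, hi⟩) h3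
        have h25 : s'.reg 25 = 1 ↔ ∃ v : Fin n, (v : ℕ) < i + 1 ∧ s.mem 4 v ≠ 1 ∧ s.mem 4 v ≠ 3 := by
          rw [hI']
          refine exists_congr fun v => and_congr_left fun hv => ?_
          rw [hsplit]
          refine ⟨.inr, fun h => h.resolve_left ?_⟩
          rintro rfl
          exact hv.2 h3
        rw [hcnt, f22, hiff, f24, f25]
        refine ⟨fun h => ⟨by omega, ?_, h25⟩, fun h => ⟨by omega, ?_, h25⟩⟩
        · rw [hI]
          constructor
          · intro hh v w hv
            rcases (hsplit v).1 hv with rfl | hv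
            · exact fun _ => h w
            · exact hh v w hv
          · exact fun hh v w hv => hh v w (by omega)
        · refine iff_of_false (by simp) fun hh => h fun w => hh ⟨i, hi⟩ w (by simp) h3
    · rw [hI]
      refine forall₂_congr fun v w => ?_
      constructor
      · intro hh hv hv3
        rcases (hsplit v).1 hv with rfl | hv
        · exact absurd hv3 h3
        · exact hh hv hv3
      · exact fun hh hv => hh (by omega)
    · rw [hI']
      refine exists_congr fun v => and_congr_left fun hv => ?_
      rw [hsplit]
      refine ⟨.inr, fun h => h.resolve_left ?_⟩
      rintro rfl
      exact hv.1 h1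
    · rw [hI]
      refine forall₂_congr fun v w => ?_
      constructor
      · intro hh hv hv3
        rcases (hsplit v).1 hv with rfl | hv
        · exact absurd hv3 h3
        · exact hh hv hv3
      · exact fun hh hv => hh (by omega)
    · exact iff_of_true trivial ⟨⟨i, hi⟩, by simp, h1, h3⟩
  · rintro t s' - ⟨ht, hI, hI'⟩
    refine ⟨by omega, ?_, ?_⟩
    · rw [hI]
      exact ⟨fun h v hv w hw => h v w v.2 hv hw, fun h v w _ hv hw => h hv hw⟩
    · rw [hI']
      exact exists_congr fun v => by simp

end CliqueCheck

/-! ### Choosing attached vertices with a common neighbour in the component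

Array `6` holds a level for every vertex: `0` outside the component, and the largest level, which is
in register `17`, for the vertices of the component that are adjacent to all attached vertices chosen
so far. Register `20` tells whether an attached vertex had to be left out, and register `19` holds such
a vertex. -/

/-- Raise the level of the neighbour in register `10` if it has the largest level. -/
def raiseLevel : Program :=
  .instr (.load 26 6 10) ;;
    .ite (.eq 26 17) (.instr (.store 6 10 27) ;; .instr (.const 18 1)) .skip

/-- Go through the attached vertices and choose those that have a neighbour of the largest level. -/
def chooseAttached : Program :=
  .instr (.const 17 1) ;; .instr (.const 20 0) ;;
    forV 7 (.instr (.load 11 4 7) ;; .ite (.eq 11 6)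
      (.instr (.const 18 0) ;; .instr (.copy 27 17) ;; .instr (.inc 27) ;;
        forAdj 7 raiseLevel ;;
        .ite (.eq 18 4) (.instr (.inc 17)) (.instr (.copy 19 7) ;; .instr (.const 20 1)))
      .skip)

section Choose

variable {n : ℕ} {G : SimpleGraph (Fin n)} {L : Fin n → List (Fin n)}

/-- The invariant of the choice: the attached vertices below `k` have been treated, and those in `T`
have been chosen. -/
structure ChooseInv (G : SimpleGraph (Fin n)) (col : Fin n → ℕ) (k : ℕ) (T : Set (Fin n)) (top : ℕ)
    (lev : ℕ → ℕ) (flag left : ℕ) : Prop where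
  subset : ∀ t ∈ T, col t = 3
  top_pos : 1 ≤ top
  zero_iff : ∀ w : Fin n, lev w = 0 ↔ col w ≠ 1
  lev_le : ∀ w : Fin n, lev w ≤ top
  top_iff : ∀ w : Fin n, lev w = top ↔ col w = 1 ∧ ∀ t ∈ T, G.Adj w t
  exists_top : ∃ w : Fin n, lev w = top
  left_out : (flag = 0 ∧ ∀ h : Fin n, (h : ℕ) < k → col h = 3 → h ∈ T) ∨
    (flag = 1 ∧ ∃ f : Fin n, left = f ∧ col f = 3 ∧
      ∀ d, col d = 1 → (∀ t ∈ T, G.Adj d t) → ¬ G.Adj d f)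

/-- Register `18` records whether any level was raised, that is, whether `v` has a common neighbour
in the component with all vertices chosen so far. -/
theorem wp_raiseLevels {s : State} (hin : HasInput L s) {v : Fin n}
    (h7 : s.reg 7 = v) (h27 : s.reg 27 = s.reg 17 + 1) (h18 : s.reg 18 = 0) :
    WP (forAdj 7 raiseLevel) s fun t s' => t ≤ 7 * (L v).length + 5 ∧
      (∀ w : Fin n, s'.mem 6 w =
        if s.mem 6 w = s.reg 17 ∧ w ∈ L v then s.reg 17 + 1 else s.mem 6 w) ∧
      (s'.reg 18 = 1 ↔ ∃ w : Fin n, s.mem 6 w = s.reg 17 ∧ w ∈ L v) := by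
  refine (WP.forAdj (L := L) hin v h7 4 (fun k s' =>
      (∀ w : Fin n, s'.mem 6 w =
        if s.mem 6 w = s.reg 17 ∧ w ∈ (L v).take k then s.reg 17 + 1 else s.mem 6 w) ∧
      (s'.reg 18 = 1 ↔ ∃ w : Fin n, s.mem 6 w = s.reg 17 ∧ w ∈ (L v).take k))
    (by decide) (by decide) (by decide) (by decide) (by decide)
    (by simp [State.reg_setReg, State.mem_setReg, h18]) ?_).mono ?_
  · rintro k hk s' hF ⟨hI, hI'⟩
    have e17 := hF.reg 17
    have e27 := (hF.reg 27).trans h27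
    have hmem : ∀ w, w ∈ (L v).take (k + 1) ↔ w ∈ (L v).take k ∨ w = (L v)[k] := by
      intro w
      rw [List.take_succ_eq_append_getElem hk, List.mem_append, List.mem_singleton]
    unfold raiseLevel
    simp only [wp_seq, wp_instr, wp_ite, wp_skip, Instr.exec, Test.Holds, State.reg_setReg,
      State.mem_setMem, State.mem_setReg, if_true, if_false, e17, e27,
      Nat.reduceEqDiff, true_and, hmem, Fin.val_inj]
    set x := (L v)[k] with hx
    refine ⟨fun h => ⟨by norm_num, fun w => ?_, ?_⟩, fun h => ⟨by norm_num, fun w => ?_, ?_⟩⟩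
    -- A vertex raised earlier in this pass has level one above register `17`, so finding the value
    -- of register `17` means that `x` has not been raised yet.
    · have hxl : s.mem 6 x = s.reg 17 := by
        have := hI x
        split_ifs at this with hc
        · omega
        · omega
      by_cases hw : w = x
      · simp [hw, hxl]
      · simp only [hw, if_false, or_false]
        exact hI w
    · have hxl : s.mem 6 x = s.reg 17 := by
        have := hI x
        split_ifs at this with hc
        · omega
        · omega
      exact iff_of_true trivial ⟨x, hxl, .inr rfl⟩
    · rw [hI w]
      by_cases hw : w = x
      · subst hw
        have := hI (L v)[k]
        split_ifs at this ⊢ with h1 h2 h2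
        · rfl
        · exact absurd ⟨h1.1, .inl h1.2⟩ h2
        · exact absurd (this.trans h2.1) h
        · rfl
      · simp [hw]
    · rw [hI']
      refine exists_congr fun w => ?_
      constructor
      · exact fun ⟨h1, h2⟩ => ⟨h1, .inl h2⟩
      · rintro ⟨h1, h2 | rfl⟩
        · exact ⟨h1, h2⟩
        · refine ⟨h1, ?_⟩
          by_contra h2
          have := hI (L v)[k]
          rw [if_neg (by tauto)] at this
          exact h (this.trans h1)
  · rintro t s' - ⟨ht, hI, hI'⟩
    simp only [List.take_length] at hI hI'
    exact ⟨by omega, hI, hI'⟩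

/-- The raised vertices are exactly those of the old largest level that are adjacent to `v`, hence
the common neighbours of `insert v T`. A vertex left out before stays incompatible, because
enlarging `T` only removes common neighbours. -/
theorem ChooseInv.choose (hL : IsAdjacencyList G L) {col : Fin n → ℕ} {v : Fin n} {T : Set (Fin n)} {top : ℕ}
    {lev lev' : ℕ → ℕ} {flag left : ℕ} (h : ChooseInv G col v T top lev flag left)
    (hv : col v = 3)
    (hlev : ∀ w : Fin n, lev' w = if lev w = top ∧ w ∈ L v then top + 1 else lev w)
    (hex : ∃ w : Fin n, lev w = top ∧ w ∈ L v) :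
    ChooseInv G col (v + 1) (insert v T) (top + 1) lev' flag left := by
  have hpos := h.top_pos
  constructor
  · rintro t (rfl | ht)
    exacts [hv, h.subset t ht]
  · omega
  · intro w
    rw [hlev, ← h.zero_iff]
    split_ifs with hc
    · have := hc.1
      exact iff_of_false not_false (by omega)
    · rfl
  · intro w
    rw [hlev]
    have := h.lev_le w
    split_ifs <;> omega
  · intro w
    have hle := h.lev_le w
    have htop := h.top_iff w
    rw [hlev]
    split_ifs with hc
    · refine iff_of_true rfl ⟨(htop.1 hc.1).1, ?_⟩
      have hvw := ((hL v).2 w).1 hc.2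
      rintro t (rfl | ht)
      exacts [hvw.symm, (htop.1 hc.1).2 t ht]
    · refine iff_of_false (by omega) fun ⟨h1, h2⟩ => hc ⟨?_, ((hL v).2 w).2 (h2 v (.inl rfl)).symm⟩
      exact htop.2 ⟨h1, fun t ht => h2 t (.inr ht)⟩
  · obtain ⟨w, hw⟩ := hex
    exact ⟨w, by rw [hlev, if_pos hw]⟩
  · refine h.left_out.imp ?_ ?_
    · rintro ⟨h1, h2⟩
      refine ⟨h1, fun x hx hx3 => ?_⟩
      by_cases hxv : x = v
      · exact .inl hxv
      · exact .inr (h2 x (by have := Fin.val_ne_of_ne hxv; omega) hx3)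
    · rintro ⟨h1, f, h2, h3, h4⟩
      exact ⟨h1, f, h2, h3, fun d hd hd' => h4 d hd fun t ht => hd' t (.inr ht)⟩

/-- No level has changed, and `v` is the new witness; a witness recorded earlier may be overwritten.
-/
theorem ChooseInv.leave (hL : IsAdjacencyList G L) {col : Fin n → ℕ} {v : Fin n} {T : Set (Fin n)} {top : ℕ}
    {lev lev' : ℕ → ℕ} {flag left : ℕ} (h : ChooseInv G col v T top lev flag left)
    (hv : col v = 3)
    (hlev : ∀ w : Fin n, lev' w = if lev w = top ∧ w ∈ L v then top + 1 else lev w)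
    (hex : ¬ ∃ w : Fin n, lev w = top ∧ w ∈ L v) :
    ChooseInv G col (v + 1) T top lev' 1 v := by
  have hlev' : ∀ w : Fin n, lev' w = lev w := fun w => by
    rw [hlev, if_neg fun hw => hex ⟨w, hw⟩]
  refine ⟨h.subset, h.top_pos, ?_, ?_, ?_, ?_, .inr ⟨rfl, v, rfl, hv, fun d hd hd' hdv => ?_⟩⟩
  · simpa only [hlev'] using h.zero_iff
  · simpa only [hlev'] using h.lev_le
  · simpa only [hlev'] using h.top_iff
  · simpa only [hlev'] using h.exists_top
  · exact hex ⟨d, (h.top_iff d).2 ⟨hd, hd'⟩, ((hL v).2 d).2 hdv.symm⟩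

theorem ChooseInv.skip {col : Fin n → ℕ} {v : Fin n} {T : Set (Fin n)} {top : ℕ} {lev : ℕ → ℕ}
    {flag left : ℕ} (h : ChooseInv G col v T top lev flag left) (hv : col v ≠ 3) :
    ChooseInv G col (v + 1) T top lev flag left := by
  refine { h with left_out := h.left_out.imp (fun ⟨h1, h2⟩ => ⟨h1, fun x hx hx3 => ?_⟩) id }
  refine h2 x ?_ hx3
  have : (x : ℕ) ≠ v := fun hxv => hv (Fin.ext hxv ▸ hx3)
  omega

theorem wp_chooseAttached (hL : IsAdjacencyList G L) {s : State} (hin : HasInput L s)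
    (hc : HasConsts s) {col : Fin n → ℕ} (hcol : ∀ v : Fin n, s.mem 4 v = col v)
    (hlev : ∀ v : Fin n, s.mem 6 v = if col v = 1 then 1 else 0) (hex : ∃ v, col v = 1) :
    WP chooseAttached s fun t s' => t ≤ 15 * n + 7 * adjOff L n + 4 ∧
      ∃ T, ChooseInv G col n T (s'.reg 17) (s'.mem 6) (s'.reg 20) (s'.reg 19) := by
  unfold chooseAttached
  simp only [wp_seq, wp_instr]
  refine (WP.forV (n := n) (fun k => 15 * k + 7 * adjOff L k)
    (fun i s' => ∃ T, ChooseInv G col i T (s'.reg 17) (s'.mem 6) (s'.reg 20) (s'.reg 19))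
    (by decide) (by decide) (by simpa [Instr.exec, State.reg_setReg] using hin.1)
    (by simp [adjOff_zero]) ?_ ?_).mono ?_
  -- With nothing chosen, every vertex of the component counts as a common neighbour and has the
  -- largest level `1`.
  · refine ⟨∅, ?_⟩
    simp only [Instr.exec, State.reg_setReg, State.mem_setReg, Nat.reduceEqDiff, if_true, if_false]
    have hlev0 : ∀ v : Fin n, s.mem 6 v = 0 ↔ col v ≠ 1 := fun v => by
      rw [hlev]; split_ifs with h <;> simp [h]
    have hlev1 : ∀ v : Fin n, s.mem 6 v = 1 ↔ col v = 1 := fun v => by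
      rw [hlev]; split_ifs with h <;> simp [h]
    refine ⟨by simp, le_rfl, hlev0, fun w => ?_, fun w => by simp [hlev1], ?_, .inl ⟨rfl, by simp⟩⟩
    · rw [hlev]; split_ifs <;> simp
    · exact hex.imp fun w hw => (hlev1 w).2 hw
  · rintro i hi s' hF h7 ⟨T, hI⟩
    have hin' : HasInput L s' :=
      HasInput.of_frame (s := ((Instr.const 20 0).exec ((Instr.const 17 1).exec s))) hin hF
    have hc' : HasConsts s' :=
      HasConsts.of_frame (s := ((Instr.const 20 0).exec ((Instr.const 17 1).exec s))) hc hF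
    have e4 : s'.mem 4 i = col ⟨i, hi⟩ := (congrFun (hF.mem 4) i).trans (hcol ⟨i, hi⟩)
    have hoff := adjOff_succ L ⟨i, hi⟩
    simp only at hoff
    simp only [wp_seq, wp_instr, wp_ite, wp_skip, Instr.exec, Test.Holds, State.reg_setReg,
      State.mem_setReg, h7, if_true, if_false, hc'.2.2.2, e4, Nat.reduceEqDiff]
    refine ⟨fun h3 => ?_, fun h3 => ⟨by omega, T, hI.skip (v := ⟨i, hi⟩) h3⟩⟩
    set s₀ := (((s'.setReg 11 (col ⟨i, hi⟩)).setReg 18 0).setReg 27 (s'.reg 17)).setReg 27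
      (s'.reg 17 + 1) with hs₀
    refine (wp_raiseLevels (s := s₀) hin' (v := ⟨i, hi⟩) (by simpa [hs₀, State.reg_setReg] using h7)
      (by simp [hs₀, State.reg_setReg]) (by simp [hs₀, State.reg_setReg])).mono ?_
    rintro t₁ s₁ hF₁ ⟨ht₁, hlev₁, h18⟩
    have f17 : s₁.reg 17 = s'.reg 17 := by rw [hF₁.reg 17]; simp [hs₀, State.reg_setReg]
    have f19 : s₁.reg 19 = s'.reg 19 := by rw [hF₁.reg 19]; simp [hs₀, State.reg_setReg]
    have f20 : s₁.reg 20 = s'.reg 20 := by rw [hF₁.reg 20]; simp [hs₀, State.reg_setReg]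
    have f7 : s₁.reg 7 = i := by rw [hF₁.reg 7]; simpa [hs₀, State.reg_setReg] using h7
    have f4 : s₁.reg 4 = 1 := by rw [hF₁.reg 4]; simpa [hs₀, State.reg_setReg] using hc'.2.1
    have g17 : s₀.reg 17 = s'.reg 17 := by simp [hs₀, State.reg_setReg]
    have g6 : s₀.mem 6 = s'.mem 6 := rfl
    rw [g17, g6] at hlev₁ h18
    rw [f4, h18]
    simp only [f17, f19, f20, f7]
    refine ⟨fun h => ⟨by omega, _, hI.choose hL h3 hlev₁ h⟩, fun h => ⟨by omega, _, hI.leave hL h3 hlev₁ h⟩⟩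
  · rintro t s' - ⟨ht, hI⟩
    exact ⟨by omega, hI⟩

end Choose

/-! ### The search for a clique separator

Array `3` marks the vertices of an inseparable set, and register `2` holds their number. Every round
finds a clique separator or enlarges the set. -/

/-- Give the vertices of the largest level colour `2`, those outside the component colour `1` and the
others colour `0`. -/
def blockCommon : Program :=
  forV 7 (.instr (.load 11 6 7) ;; .ite (.eq 11 17) (.instr (.store 4 7 5))
    (.ite (.eq 11 3) (.instr (.store 4 7 4)) (.instr (.store 4 7 3))))

/-- Find a vertex of the largest level that is reached from the vertex in register `19` through
vertices of the component of smaller level. -/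
def pickReached : Program :=
  blockCommon ;; .instr (.copy 16 19) ;; flood ;; findEq 21 4 6

/-- Enlarge the inseparable set. -/
def extend : Program :=
  mapIf 4 4 6 4 3 ;; chooseAttached ;; .ite (.eq 20 3) (findEq 21 6 17) pickReached ;;
    .instr (.store 3 21 4) ;; .instr (.inc 2)

/-- Output the vertices of colour `3` as a clique separator. -/
def report : Program :=
  mapIf 4 6 2 4 3 ;; .instr (.const 1 1) ;; .instr (.copy 2 0)

/-- One round of the search. -/
def round : Program :=
  mapIf 3 3 4 3 5 ;; findEq 16 3 3 ;; flood ;; countAttached ;; cliqueCheck ;;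
    .ite (.eq 24 4) (.ite (.eq 25 4) report extend) extend

section Round

variable {n : ℕ} {G : SimpleGraph (Fin n)} {L : Fin n → List (Fin n)}

theorem wp_blockCommon {s : State} (hn : s.reg 0 = n) (hc : HasConsts s) :
    WP blockCommon s fun t s' => t ≤ 6 * n + 2 ∧ ∀ v : Fin n, s'.mem 4 v =
      if s.mem 6 v = s.reg 17 then 2 else if s.mem 6 v = 0 then 1 else 0 := by
  refine WP.map hn 4 _ 4 (by decide) (by decide) ?_
  intro v s' hF h7 _
  have hc' := hc.of_frame hF
  have h17 := hF.reg 17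
  have h6 := hF.mem 6
  simp only [wp_seq, wp_instr, wp_ite, Instr.exec, Test.Holds, State.reg_setReg, h7, if_true,
    if_false, h17, h6, hc'.1, hc'.2.1, hc'.2.2.1, State.mem_setMem, State.mem_setReg, true_and,
    Nat.reduceEqDiff]
  exact ⟨fun h => by simp [h], fun h => ⟨fun h' => ⟨by norm_num, fun _ => by rw [if_neg h, if_pos h']⟩,
    fun h' => by simp [h, h']⟩⟩

/-- The vertices of the largest level are blocked, so the search stops at them. Those it touches
become colour `3` and are the admissible choices of `z`. -/
theorem wp_pickReached (hL : IsAdjacencyList G L) {s : State} (hin : HasInput L s)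
    (hc : HasConsts s) {A : Set (Fin n)} {f : Fin n} (hf : s.reg 19 = f) (hfA : s.mem 6 f = 0)
    (hA : ∀ v : Fin n, s.mem 6 v ≠ 0 ↔ v ∈ A) (htop : 1 ≤ s.reg 17)
    (hex : ∃ x, ReachIn G A f x ∧ s.mem 6 x = s.reg 17) :
    WP pickReached s fun t s' => t ≤ 19 * n + 8 * adjOff L n + 10 ∧ ∃ z u : Fin n, s'.reg 21 = z ∧
      s.mem 6 z = s.reg 17 ∧ ReachIn G {d | d ∈ A ∧ s.mem 6 d ≠ s.reg 17} f u ∧ G.Adj u z := by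
  unfold pickReached
  refine (wp_blockCommon hin.1 hc).seq ?_
  rintro t₁ s₁ hF₁ ⟨ht₁, hcol₁⟩
  have hin₁ := hin.of_frame hF₁
  have hc₁ := hc.of_frame hF₁
  have f19 : s₁.reg 19 = f := (hF₁.reg 19).trans hf
  rw [wp_seq, wp_instr]
  simp only [Instr.exec, f19]
  set c : Fin n → ℕ := fun v =>
    if s.mem 6 v = s.reg 17 then 2 else if s.mem 6 v = 0 then 1 else 0 with hcdef
  have hc0 : {x | c x = 0} = {d | d ∈ A ∧ s.mem 6 d ≠ s.reg 17} := by
    ext x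
    simp only [hcdef, Set.mem_ofPred_eq, ← hA]
    split_ifs with h1 h2
    · simp [h1]
    · simp [h2]
    · simp [h1, h2]
  have hcf : c f = 1 := by
    simp only [hcdef, hfA, if_true]
    rw [if_neg (by omega)]
  have hcle : ∀ w, c w ≤ 2 := by
    intro w
    simp only [hcdef]
    split_ifs <;> simp
  have hc2 : ∀ w, c w = 2 ↔ s.mem 6 w = s.reg 17 := by
    intro w
    simp only [hcdef]
    split_ifs with h1
    · exact iff_of_true rfl h1
    · exact iff_of_false (by simp) h1
    · exact iff_of_false (by simp) h1
  refine (wp_flood (s := s₁.setReg 16 f) hL hin₁ hc₁ (c := c) hcol₁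
    (v := f) (by simp [State.reg_setReg]) (by omega)).seq ?_
  rintro t₂ s₂ hF₂ ⟨ht₂, hcol₂⟩
  have hin₂ : HasInput L s₂ := HasInput.of_frame (s := s₁.setReg 16 f) hin₁ hF₂
  have hc₂ : HasConsts s₂ := HasConsts.of_frame (s := s₁.setReg 16 f) hc₁ hF₂
  refine (wp_findEq hin₂.1 (by decide) (by decide)).mono ?_
  rw [hc₂.2.2.2]
  -- Following a walk inside `A`, either it stays below the largest level or its first vertex of
  -- that level is adjacent to a reached vertex.
  have hfound : ∀ y, ReachIn G A f y → ReachIn G {x | c x = 0} f y ∨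
      ∃ z u, c z = 2 ∧ ReachIn G {x | c x = 0} f u ∧ G.Adj u z := by
    intro y hy
    induction hy with
    | refl => exact .inl .refl
    | @tail b d _ h ih =>
      refine ih.elim (fun hb => ?_) .inr
      by_cases hd : s.mem 6 d = s.reg 17
      · exact .inr ⟨d, b, (hc2 d).2 hd, hb, h.1⟩
      · exact .inl (hb.trans (.of_adj h.1 (hc0 ▸ ⟨h.2, hd⟩)))
  rintro t₃ s₃ - ⟨ht₃, h | ⟨z, hz, hz'⟩⟩
  · exfalso
    obtain ⟨x, hx, hxt⟩ := hex
    have : ∃ z u, c z = 2 ∧ ReachIn G {x | c x = 0} f u ∧ G.Adj u z := by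
      refine (hfound x hx).resolve_left fun hx' => ?_
      have h1 := (hc2 x).2 hxt
      have h2 : c x = 0 := hx'.mem_of_ne (by rintro rfl; omega)
      omega
    obtain ⟨z, u, hz, hu, huz⟩ := this
    have hzR : ¬ ReachIn G {x | c x = 0} f z := fun hz' => by
      have h2 : c z = 0 := hz'.mem_of_ne (by rintro rfl; omega)
      omega
    rcases ((hcol₂ z).2 hzR).2 hz with h' | h'
    · exact h.1 z h'.1
    · exact h'.2 ⟨u, hu, huz⟩
  -- Colours before the search are at most `2`, so a `3` was written by the search: `z` is blocked
  -- and touched.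
  · have hzR : ¬ ReachIn G {x | c x = 0} f z := fun h => by
      have := (hcol₂ z).1 h
      omega
    have hz2 : c z = 2 := by
      by_contra h
      have h1 := ((hcol₂ z).2 hzR).1 h
      have h2 := hcle z
      omega
    rcases ((hcol₂ z).2 hzR).2 hz2 with ⟨-, u, hu, huz⟩ | h'
    · exact ⟨by omega, z, u, hz', (hc2 z).1 hz2, hc0 ▸ hu, huz⟩
    · omega

/-- Register `20` distinguishes the two ways of enlarging `H`: if it is `0`, all attached vertices
were chosen and a vertex of the largest level dominates them; otherwise register `19` holds the
vertex `f` left out. -/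
theorem wp_extend (hL : IsAdjacencyList G L) {s : State} (hin : HasInput L s) (hc : HasConsts s)
    {H : Set (Fin n)} (hH : Inseparable G H) {v : Fin n} (hv : v ∉ H)
    (hcomp : ∀ w : Fin n, s.mem 4 w = 1 ↔ w ∈ compOf G H v)
    (hatt : ∀ w : Fin n, s.mem 4 w = 3 ↔ w ∈ attach G H v)
    (hN : G.IsClique (attach G H v) → ∀ x, x ∈ compOf G H v ∨ x ∈ attach G H v) :
    WP extend s fun t s' => t ≤ 39 * n + 15 * adjOff L n + 19 ∧ s'.reg 2 = s.reg 2 + 1 ∧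
      ∃ z ∉ H, Inseparable G (insert z H) ∧
        ∀ w : Fin n, s'.mem 3 w = if w = z then 1 else s.mem 3 w := by
  unfold extend
  refine (wp_mapIf hin.1 (by decide) (by decide) (by decide) (by decide)).seq ?_
  rw [hc.1, hc.2.1]
  rintro t₁ s₁ hF₁ ⟨ht₁, hlev₁⟩
  have hin₁ := hin.of_frame hF₁
  have hc₁ := hc.of_frame hF₁
  have hcol₁ := hF₁.mem 4
  refine (wp_chooseAttached hL hin₁ hc₁ (col := fun v => s.mem 4 v) (by simp [hcol₁]) hlev₁
    ⟨v, (hcomp v).2 .refl⟩).seq ?_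
  rintro t₂ s₂ hF₂ ⟨ht₂, T, hI⟩
  have hin₂ := hin₁.of_frame hF₂
  have hc₂ := hc₁.of_frame hF₂
  have hTsub : T ⊆ attach G H v := fun t ht => (hatt t).1 (hI.subset t ht)
  have key : ∀ (p : Program) (T₀ : ℕ), p.regs.contains 2 = false → p.arrs.contains 3 = false →
      p.regs.contains 4 = false →
      (WP p s₂ fun t s' => t ≤ T₀ ∧ ∃ z : Fin n, s'.reg 21 = z ∧ s.mem 4 z = 1 ∧
        Inseparable G (insert z H)) →
      WP p s₂ fun t s' => t ≤ T₀ ∧ s'.reg 2 = s.reg 2 ∧ s'.reg 4 = 1 ∧ s'.mem 3 = s.mem 3 ∧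
        ∃ z : Fin n, s'.reg 21 = z ∧ s.mem 4 z = 1 ∧ Inseparable G (insert z H) := by
    intro p T₀ h2 h3 h4 h
    refine h.mono ?_
    rintro t s' hF ⟨ht, h⟩
    simp only [List.contains_eq_mem, decide_eq_false_iff_not] at h2 h3 h4
    refine ⟨ht, ?_, ?_, ?_, h⟩
    · rw [hF.1 2 h2, hF₂.reg 2, hF₁.reg 2]
    · rw [hF.1 4 h4, hc₂.2.1]
    · rw [hF.2 3 h3, hF₂.mem 3, hF₁.mem 3]
  have hpick : WP (.ite (.eq 20 3) (findEq 21 6 17) pickReached) s₂ fun t s' =>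
      t ≤ 19 * n + 8 * adjOff L n + 11 ∧ s'.reg 2 = s.reg 2 ∧ s'.reg 4 = 1 ∧ s'.mem 3 = s.mem 3 ∧
        ∃ z : Fin n, s'.reg 21 = z ∧ s.mem 4 z = 1 ∧ Inseparable G (insert z H) := by
    refine key _ _ (by decide) (by decide) (by decide) ?_
    rw [wp_ite]
    simp only [Test.Holds, hc₂.1]
    constructor
    · intro h20
      refine (wp_findEq hin₂.1 (by decide) (by decide)).mono ?_
      rintro t₃ s₃ - ⟨ht₃, h | ⟨z, hz, hz'⟩⟩
      · obtain ⟨w, hw⟩ := hI.exists_top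
        exact absurd hw (h.1 w)
      · have hz1 := (hI.top_iff z).1 hz
        refine ⟨by omega, z, hz', hz1.1, hH.insert_of_dominating hv hN fun x hx => hz1.2 x ?_⟩
        rcases hI.left_out with h | h
        · exact h.2 x x.2 ((hatt x).2 hx)
        · omega
    · intro h20
      obtain ⟨-, f, hf, hf3, hfT⟩ := hI.left_out.resolve_left fun h => h20 h.1
      have hfatt := (hatt f).1 hf3
      have hA : ∀ v' : Fin n, s₂.mem 6 v' ≠ 0 ↔ v' ∈ compOf G H v := by
        intro w
        rw [ne_eq, hI.zero_iff, not_not, hcomp]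
      have htop : ∀ d ∈ compOf G H v, s₂.mem 6 d ≠ s₂.reg 17 → ¬ ∀ t ∈ T, G.Adj d t :=
        fun d hd h h' => h ((hI.top_iff d).2 ⟨(hcomp d).2 hd, h'⟩)
      refine (wp_pickReached hL hin₂ hc₂ (A := compOf G H v) hf ?_ hA hI.top_pos ?_).mono ?_
      · exact (hI.zero_iff f).2 (by omega)
      -- The search succeeds because `f` has a neighbour in the component, which is connected and
      -- contains a vertex of the largest level.
      · obtain ⟨x, hx⟩ := hI.exists_top
        obtain ⟨d, hd, hdf⟩ := hfatt.2
        have hxc := (hcomp x).1 ((hI.top_iff x).1 hx).1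
        exact ⟨x, (ReachIn.of_adj hdf.symm hd).trans (reachIn_compOf hv hd hxc), hx⟩
      · rintro t₃ s₃ - ⟨ht₃, z, u, hz', hz, hu, huz⟩
        have hz1 := (hI.top_iff z).1 hz
        refine ⟨by omega, z, hz', hz1.1, hH.insert_of_reach hv hN hTsub hfatt ?_
          ((hcomp z).1 hz1.1) hz1.2 (hu.mono fun d hd => ⟨hd.1, htop d hd.1 hd.2⟩) huz⟩
        exact fun d hd => hfT d ((hcomp d).2 hd)
  refine hpick.seq ?_
  rintro t₃ s₃ - ⟨ht₃, h2, h4, h3, z, hz, hz1, hins⟩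
  simp only [wp_seq, wp_instr, Instr.exec, State.reg_setReg, State.reg_setMem, State.mem_setReg,
    State.mem_setMem, hz, h2, h3, h4, if_true, true_and, Fin.val_inj]
  exact ⟨by omega, z, notMem_of_mem_compOf hv ((hcomp z).1 hz1), hins, fun _ => rfl⟩

/-- The state between two rounds: no clique separator has been found yet, and array `3` marks an
inseparable set. -/
structure SearchInv (G : SimpleGraph (Fin n)) (L : Fin n → List (Fin n)) (s : State) : Prop where
  input : HasInput L s
  consts : HasConsts s
  not_found : s.reg 1 = 0
  card_eq : s.reg 2 = (Finset.univ.filter fun v : Fin n => s.mem 3 v ≠ 0).card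
  inseparable : Inseparable G {v : Fin n | s.mem 3 v ≠ 0}
  preconnected : s.reg 2 ≠ 0 → G.Preconnected

/-- With `H = ∅` nothing is attached, and the empty set is a clique. A first round that does not
report a separator has therefore reached every vertex. -/
theorem preconnected_of_compOf {v : Fin n} (h : ∀ x, x ∈ compOf G ∅ v) : G.Preconnected := by
  have key : ∀ x, G.Reachable v x := by
    intro x
    obtain ⟨w, -⟩ := (show ReachIn G ∅ᶜ v x from h x).exists_walk
    exact ⟨w⟩
  exact fun x y => (key x).symm.trans (key y)

/-- Setting register `2` to `n` ends the main loop. -/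
theorem wp_report {s : State} (hn : s.reg 0 = n) (hc : HasConsts s) :
    WP report s fun t s' => t ≤ 5 * n + 4 ∧ s'.reg 1 = 1 ∧ s'.reg 2 = n ∧
      {v : Fin n | s'.mem 2 v = 1} = {v : Fin n | s.mem 4 v = 3} := by
  unfold report
  refine (wp_mapIf hn (by decide) (by decide) (by decide) (by decide)).seq ?_
  rintro t₁ s₁ hF₁ ⟨ht₁, hout⟩
  have hn₁ : s₁.reg 0 = n := (hF₁.reg 0).trans hn
  rw [hc.1, hc.2.1, hc.2.2.2] at hout
  simp only [wp_seq, wp_instr, Instr.exec, State.reg_setReg, State.mem_setReg, hn₁, hout, if_true,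
    Nat.reduceEqDiff, if_false, true_and]
  refine ⟨by omega, ?_⟩
  ext v
  simp

theorem wp_round (hL : IsAdjacencyList G L) {s : State} (h : SearchInv G L s) (hlt : s.reg 2 < n) :
    WP round s fun t s' => t ≤ 76 * n + 31 * adjOff L n + 40 ∧
      ((SearchInv G L s' ∧ s'.reg 2 = s.reg 2 + 1 ∧ G.Preconnected) ∨
        (HasInput L s' ∧ HasConsts s' ∧ s'.reg 1 = 1 ∧ s'.reg 2 = n ∧
          IsCliqueSeparator G {v : Fin n | s'.mem 2 v = 1})) := by
  obtain ⟨hin, hc, hr1, hcard, hins, hpre⟩ := h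
  set H : Set (Fin n) := {v : Fin n | s.mem 3 v ≠ 0} with hH
  have hframe : ∀ s', Frame round s s' → HasInput L s' ∧ HasConsts s' := fun s' hF =>
    ⟨hin.of_frame hF, hc.of_frame hF⟩
  suffices hmain : WP round s fun t s' => t ≤ 76 * n + 31 * adjOff L n + 40 ∧
      ((s'.reg 1 = 0 ∧ s'.reg 2 = s.reg 2 + 1 ∧ G.Preconnected ∧
        ∃ z ∉ H, Inseparable G (insert z H) ∧
          ∀ w : Fin n, s'.mem 3 w = if w = z then 1 else s.mem 3 w) ∨
        (s'.reg 1 = 1 ∧ s'.reg 2 = n ∧ IsCliqueSeparator G {v : Fin n | s'.mem 2 v = 1})) by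
    refine hmain.mono ?_
    rintro t s' hF ⟨ht, ⟨h1, h2, hp, z, hz, hins', hm⟩ | h⟩
    · obtain ⟨hin', hc'⟩ := hframe s' hF
      refine ⟨ht, .inl ⟨⟨hin', hc', h1, ?_, ?_, fun _ => hp⟩, h2, hp⟩⟩
      · rw [h2, hcard]
        have : (Finset.univ.filter fun v : Fin n => s'.mem 3 v ≠ 0) =
            insert z (Finset.univ.filter fun v : Fin n => s.mem 3 v ≠ 0) := by
          ext w
          simp only [Finset.mem_filter, Finset.mem_univ, true_and, Finset.mem_insert, hm]
          split_ifs with hw <;> simp [hw]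
        rw [this, Finset.card_insert_of_notMem (by simpa [hH] using hz)]
      · convert hins' using 1
        ext w
        simp only [Set.mem_ofPred_eq, hm, Set.mem_insert_iff, hH]
        split_ifs with hw <;> simp [hw]
    · obtain ⟨hin', hc'⟩ := hframe s' hF
      exact ⟨ht, .inr ⟨hin', hc', h⟩⟩
  unfold round
  refine (wp_mapIf hin.1 (by decide) (by decide) (by decide) (by decide)).seq ?_
  rw [hc.1, hc.2.2.1]
  rintro t₁ s₁ hF₁ ⟨ht₁, hcol₁⟩
  have hin₁ := hin.of_frame hF₁
  have hc₁ := hc.of_frame hF₁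
  refine (wp_findEq hin₁.1 (by decide) (by decide)).seq ?_
  rw [hc₁.1, hF₁.mem 3]
  rintro t₂ s₂ hF₂ ⟨ht₂, hno | ⟨v, hv, hv16⟩⟩
  -- Fewer than `n` vertices are marked, so an unmarked one is found.
  · exfalso
    have : (Finset.univ.filter fun v : Fin n => s.mem 3 v ≠ 0) = Finset.univ := by
      ext v; simpa using hno.1 v
    rw [this, Finset.card_univ, Fintype.card_fin] at hcard
    omega
  have hin₂ := hin₁.of_frame hF₂
  have hc₂ := hc₁.of_frame hF₂
  have hvH : v ∉ H := by simpa [hH] using hv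
  set c : Fin n → ℕ := fun v => if s.mem 3 v = 0 then 0 else 2 with hcdef
  have hc0 : {x | c x = 0} = Hᶜ := by
    ext x
    simp [hcdef, hH]
  have hc2 : ∀ x, c x = 2 ↔ x ∈ H := by
    intro x
    simp [hcdef, hH]
  have hc02 : ∀ x, c x ≠ 2 → c x = 0 := by
    intro x
    simp [hcdef]
  refine (wp_flood hL hin₂ hc₂ (c := c) (by rw [hF₂.mem 4]; exact hcol₁) hv16
    (fun h => hvH ((hc2 v).1 h))).seq ?_
  rw [hc0]
  rintro t₃ s₃ hF₃ ⟨ht₃, hcol₃⟩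
  have hin₃ := hin₂.of_frame hF₃
  have hc₃ := hc₂.of_frame hF₃
  have hcomp : ∀ w : Fin n, s₃.mem 4 w = 1 ↔ w ∈ compOf G H v := by
    intro w
    refine ⟨fun hw => ?_, (hcol₃ w).1⟩
    by_contra hw'
    have := (hcol₃ w).2 hw'
    by_cases h2 : c w = 2
    · have := this.2 h2; omega
    · have := this.1 h2
      have := hc02 w h2
      omega
  have hatt : ∀ w : Fin n, s₃.mem 4 w = 3 ↔ w ∈ attach G H v := by
    intro w
    constructor
    · intro hw
      have hw' : ¬ ReachIn G Hᶜ v w := fun h => by have := (hcol₃ w).1 h; omega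
      have := (hcol₃ w).2 hw'
      by_cases h2 : c w = 2
      · exact ⟨(hc2 w).1 h2, ((this.2 h2).resolve_right (by omega)).2⟩
      · have := this.1 h2
        have := hc02 w h2
        omega
    · rintro ⟨hwH, hex⟩
      have hw' : ¬ ReachIn G Hᶜ v w := fun h => h.mem hvH hwH
      exact ((((hcol₃ w).2 hw').2 ((hc2 w).2 hwH)).resolve_right fun h => h.2 hex).1
  have hset : {w : Fin n | s₃.mem 4 w = 3} = attach G H v := Set.ext hatt
  refine (wp_countAttached hin₃.1 hc₃.2.2.2).seq ?_
  rintro t₄ s₄ hF₄ ⟨ht₄, h22⟩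
  have hin₄ := hin₃.of_frame hF₄
  have hc₄ := hc₃.of_frame hF₄
  rw [← hF₄.mem 4] at hcomp hatt hset h22
  refine (wp_cliqueCheck hL hin₄ hc₄ h22).seq ?_
  rintro t₅ s₅ hF₅ ⟨ht₅, h24, h25⟩
  have hin₅ := hin₄.of_frame hF₅
  have hc₅ := hc₄.of_frame hF₅
  rw [hset] at h24
  rw [← hF₅.mem 4] at hcomp hatt hset h25
  have f2 : s₅.reg 2 = s.reg 2 := by
    rw [hF₅.reg 2, hF₄.reg 2, hF₃.reg 2, hF₂.reg 2, hF₁.reg 2]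
  have f1 : s₅.reg 1 = 0 := by
    rw [hF₅.reg 1, hF₄.reg 1, hF₃.reg 1, hF₂.reg 1, hF₁.reg 1, hr1]
  have f3 : s₅.mem 3 = s.mem 3 := by
    rw [hF₅.mem 3, hF₄.mem 3, hF₃.mem 3, hF₂.mem 3, hF₁.mem 3]
  have hext : (G.IsClique (attach G H v) → ∀ x, x ∈ compOf G H v ∨ x ∈ attach G H v) →
      WP extend s₅ fun t s' => t ≤ 39 * n + 15 * adjOff L n + 19 ∧ s'.reg 1 = 0 ∧
        s'.reg 2 = s.reg 2 + 1 ∧ G.Preconnected ∧ ∃ z ∉ H, Inseparable G (insert z H) ∧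
          ∀ w : Fin n, s'.mem 3 w = if w = z then 1 else s.mem 3 w := by
    intro hN
    refine (wp_extend hL hin₅ hc₅ hins hvH hcomp hatt hN).mono ?_
    rintro t s' hF ⟨ht, h2, z, hz, hins', hm⟩
    rw [f2] at h2
    rw [f3] at hm
    refine ⟨ht, (hF.reg 1).trans f1, h2, ?_, z, hz, hins', hm⟩
    by_cases h0 : s.reg 2 = 0
    · have hH0 : H = ∅ := by
        rw [h0, eq_comm, Finset.card_eq_zero] at hcard
        refine Set.eq_empty_iff_forall_notMem.2 fun w hw => ?_
        have : w ∈ (Finset.univ.filter fun v : Fin n => s.mem 3 v ≠ 0) := by simpa [hH] using hw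
        simp [hcard] at this
      have hatt0 : attach G ∅ v = ∅ := Set.eq_empty_of_subset_empty fun x hx => hx.1
      rw [hH0, hatt0] at hN
      exact preconnected_of_compOf fun x => (hN (by simp) x).resolve_right (Set.notMem_empty x)
    · exact hpre h0
  have hunc : (¬ ∃ v : Fin n, s₅.mem 4 v ≠ 1 ∧ s₅.mem 4 v ≠ 3) →
      ∀ x, x ∈ compOf G H v ∨ x ∈ attach G H v := by
    intro h x
    rw [← hcomp, ← hatt]
    by_contra hx
    exact h ⟨x, not_or.1 hx⟩
  simp only [wp_ite, Test.Holds, hc₅.2.1, h24, h25]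
  refine ⟨fun hcl => ⟨fun hu => ?_, fun hu => ?_⟩, fun hcl => ?_⟩
  · obtain ⟨x, hx1, hx3⟩ := hu
    refine (wp_report hin₅.1 hc₅).mono ?_
    rintro t₆ s₆ - ⟨ht₆, h1, h2, hout⟩
    refine ⟨by omega, .inr ⟨h1, h2, ?_⟩⟩
    rw [hout, hset]
    exact isCliqueSeparator_attach hvH hcl (fun h => hx1 ((hcomp x).2 h)) fun h => hx3 ((hatt x).2 h)
  · refine (hext fun _ => hunc hu).mono ?_
    rintro t₆ s₆ - ⟨ht₆, h⟩
    exact ⟨by omega, .inl h⟩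
  · refine (hext fun h => absurd h hcl).mono ?_
    rintro t₆ s₆ - ⟨ht₆, h⟩
    exact ⟨by omega, .inl h⟩

end Round

/-! ### The test for co-bipartite graphs

Array `7` holds a colour of every vertex, with `0` for uncoloured vertices, and array `8` its status: `0`
for an uncoloured, `1` for a coloured and `2` for a treated vertex. Register `28` is set to `1` when a
conflict is found. -/

/-- Choose an untreated vertex for register `21`, a coloured one if there is any, and treat it. -/
def pickVertex : Program :=
  findEq 21 8 3 ;; findEq 21 8 4 ;; .instr (.load 11 8 21) ;;
    .ite (.eq 11 3) (.instr (.store 7 21 4)) .skip ;; .instr (.store 8 21 5) ;;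
    .instr (.load 30 7 21) ;; .ite (.eq 30 4) (.instr (.copy 31 5)) (.instr (.copy 31 4))

/-- Mark the vertex in register `21` and its neighbours in array `9`. -/
def markNeighbours : Program :=
  mapIf 8 3 9 3 3 ;; .instr (.store 9 21 4) ;; forAdj 21 (.instr (.store 9 10 4))

/-- Give every uncoloured unmarked vertex the colour in register `31`, and report a conflict if an
unmarked vertex has the colour in register `30`. -/
def colourUnmarked : Program :=
  forV 7 (.instr (.load 11 9 7) ;; .ite (.eq 11 3)
    (.instr (.load 26 7 7) ;; .ite (.eq 26 3) (.instr (.store 7 7 31) ;; .instr (.store 8 7 4))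
      (.ite (.eq 26 30) (.instr (.const 28 1)) .skip)) .skip)

/-- Colour the complement of the graph. -/
def colourComplement : Program :=
  .instr (.const 28 0) ;; forV 29 (pickVertex ;; markNeighbours ;; colourUnmarked)

section Colour

variable {n : ℕ} {G : SimpleGraph (Fin n)} {L : Fin n → List (Fin n)}

/-- A proper colouring of the complement with the colours `1` and `2`. -/
def IsColouring (G : SimpleGraph (Fin n)) (χ : Fin n → ℕ) : Prop :=
  (∀ v, χ v = 1 ∨ χ v = 2) ∧ ∀ u w, Gᶜ.Adj u w → χ u ≠ χ w

theorem isCoBipartite_iff : IsCoBipartite G ↔ ∃ χ, IsColouring G χ := by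
  constructor
  · rintro ⟨C⟩
    refine ⟨fun v => C v + 1, fun v => ?_, fun u w huw h => C.valid huw ?_⟩
    · have := (C v).isLt
      simp only
      omega
    · exact Fin.ext (by simpa using h)
  · rintro ⟨χ, h, h'⟩
    refine ⟨SimpleGraph.Coloring.mk (fun v => if χ v = 1 then (0 : Fin 2) else 1) ?_⟩
    intro u w huw heq
    have := h' u w huw
    have hu := h u
    have hw := h w
    split_ifs at heq <;> omega

/-- The invariant of the colouring. -/
structure ColourInv (G : SimpleGraph (Fin n)) (col st : ℕ → ℕ) (bad : ℕ) : Prop where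
  status_iff : ∀ v : Fin n, st v = 0 ↔ col v = 0
  status_le : ∀ v : Fin n, st v ≤ 2
  col_le : ∀ v : Fin n, col v ≤ 2
  closed : ∀ u w : Fin n, st u = 2 → Gᶜ.Adj u w → col w ≠ 0
  proper : bad ≠ 1 → ∀ u w : Fin n, st u = 2 → Gᶜ.Adj u w → col u ≠ col w
  extends_ : ∀ χ, IsColouring G χ → bad ≠ 1 ∧
    ∃ χ', IsColouring G χ' ∧ ∀ v : Fin n, col v ≠ 0 → χ' v = col v

/-- When all coloured vertices have been treated, a further vertex may be coloured at will. -/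
theorem ColourInv.start {col st col' st' : ℕ → ℕ} {bad : ℕ} (h : ColourInv G col st bad) {u : Fin n}
    (hu : st u = 0) (hst : ∀ v : Fin n, st v ≠ 1)
    (hcol' : ∀ v : Fin n, col' v = if v = u then 1 else col v)
    (hst' : ∀ v : Fin n, st' v = if v = u then 1 else st v) : ColourInv G col' st' bad := by
  have h2 : ∀ v : Fin n, col v ≠ 0 → st v = 2 := by
    intro v hv
    have h1 := hst v
    have h2 := h.status_le v
    have h3 := mt (h.status_iff v).1 hv
    omega
  have h2' : ∀ v : Fin n, st' v = 2 → v ≠ u ∧ st v = 2 := by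
    intro v hv
    rw [hst'] at hv
    by_cases hvu : v = u
    · simp [hvu] at hv
    · exact ⟨hvu, by simpa [hvu] using hv⟩
  -- The treated vertices form a union of components of the complement.
  have hadj : ∀ v w : Fin n, st v = 2 → Gᶜ.Adj v w → st w = 2 := fun v w hv hvw =>
    h2 w (h.closed v w hv hvw)
  have hu2 : ∀ v : Fin n, st v = 2 → Gᶜ.Adj v u → False := fun v hv hvu => by
    have := hadj v u hv hvu
    omega
  constructor
  · intro v
    rw [hst', hcol']
    split_ifs
    · simp
    · exact h.status_iff v
  · intro v
    rw [hst']
    have := h.status_le v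
    split_ifs <;> omega
  · intro v
    rw [hcol']
    have := h.col_le v
    split_ifs <;> omega
  · intro v w hv hvw
    obtain ⟨-, hv⟩ := h2' v hv
    rw [hcol']
    split_ifs
    · simp
    · exact h.closed v w hv hvw
  · intro hb v w hv hvw
    obtain ⟨hvu, hv⟩ := h2' v hv
    have hwu : w ≠ u := by
      rintro rfl
      exact hu2 v hv hvw
    rw [hcol', hcol', if_neg hvu, if_neg hwu]
    exact h.proper hb v w hv hvw
  · intro χ hχ
    obtain ⟨hb, χ', ⟨hc, hp⟩, hag⟩ := h.extends_ χ hχ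
    -- If `χ'` does not give `u` the colour `1`, the two colours are exchanged by `3 - χ' v` on all
    -- untreated vertices. No edge of the complement joins these to treated ones.
    refine ⟨hb, fun v => if st v = 2 then χ' v else if χ' u = 1 then χ' v else 3 - χ' v, ⟨?_, ?_⟩, ?_⟩
    · intro v
      have := hc v
      simp only
      split_ifs <;> omega
    · intro v w hvw
      have h1 := hp v w hvw
      have h3 := hc v
      have h4 := hc w
      by_cases hv : st v = 2
      · simpa [hv, hadj v w hv hvw] using h1
      · have hw : st w ≠ 2 := fun hw => hv (hadj w v hw hvw.symm)
        simp only [hv, hw, if_false]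
        split_ifs <;> omega
    · intro v hv
      rw [hcol'] at hv ⊢
      by_cases hvu : v = u
      · subst hvu
        have := hc v
        have hv2 : st v ≠ 2 := by omega
        simp only [hv2, if_false, if_true]
        split_ifs <;> omega
      · simp only [hvu, if_false] at hv ⊢
        rw [if_pos (h2 v hv)]
        exact hag v hv

theorem ColourInv.congr {col st col' st' : ℕ → ℕ} {bad : ℕ} (h : ColourInv G col st bad)
    (hcol : ∀ v : Fin n, col' v = col v) (hst : ∀ v : Fin n, st' v = st v) :
    ColourInv G col' st' bad := by
  obtain ⟨h1, h2, h3, h4, h5, h6⟩ := h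
  constructor <;> simpa only [hcol, hst]

/-- A coloured vertex is treated by colouring the vertices not adjacent to it. -/
theorem ColourInv.treat {col st col' st' : ℕ → ℕ} {bad bad' : ℕ} (h : ColourInv G col st bad)
    {u : Fin n} {d : ℕ} (hu : col u ≠ 0) (hd : d = if col u = 1 then 2 else 1)
    (hst₁ : ∀ v : Fin n, (col v = 0 ∧ Gᶜ.Adj u v → st' v = 1))
    (hst₂ : ∀ v : Fin n, (¬ (col v = 0 ∧ Gᶜ.Adj u v) → st' v = if v = u then 2 else st v))
    (hcol₁ : ∀ v : Fin n, (col v = 0 ∧ Gᶜ.Adj u v → col' v = d))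
    (hcol₂ : ∀ v : Fin n, (¬ (col v = 0 ∧ Gᶜ.Adj u v) → col' v = col v))
    (hbad : bad' = 1 ↔ bad = 1 ∨ ∃ v : Fin n, Gᶜ.Adj u v ∧ col v = col u) :
    ColourInv G col' st' bad' := by
  have hcu := h.col_le u
  have hd12 : d = 1 ∨ d = 2 := by rw [hd]; split_ifs <;> simp
  have hdu : d ≠ col u := by rw [hd]; split_ifs <;> omega
  have hsu := mt (h.status_iff u).1 hu
  have hcol0 : ∀ v : Fin n, col v ≠ 0 → col' v = col v := fun v hv => hcol₂ v fun h => hv h.1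
  have hst' : ∀ v : Fin n, st' v = 2 → v = u ∨ st v = 2 := by
    intro v hv
    by_cases hc : col v = 0 ∧ Gᶜ.Adj u v
    · have := hst₁ v hc
      omega
    · have := hst₂ v hc
      split_ifs at this with hvu
      · exact .inl hvu
      · exact .inr (this ▸ hv)
  have hcl : ∀ v w : Fin n, st' v = 2 → Gᶜ.Adj v w → col' w ≠ 0 := by
    intro v w hv hvw
    by_cases hw : col w = 0
    · rcases hst' v hv with rfl | hv
      · rw [hcol₁ w ⟨hw, hvw⟩]; omega
      · exact absurd hw (h.closed v w hv hvw)
    · rwa [hcol0 w hw]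
  constructor
  · intro v
    by_cases hc : col v = 0 ∧ Gᶜ.Adj u v
    · rw [hst₁ v hc, hcol₁ v hc]; omega
    · rw [hst₂ v hc, hcol₂ v hc]
      split_ifs with hvu
      · subst hvu; simp [hu]
      · exact h.status_iff v
  · intro v
    by_cases hc : col v = 0 ∧ Gᶜ.Adj u v
    · rw [hst₁ v hc]; norm_num
    · rw [hst₂ v hc]
      have := h.status_le v
      split_ifs <;> omega
  · intro v
    by_cases hc : col v = 0 ∧ Gᶜ.Adj u v
    · rw [hcol₁ v hc]; omega
    · rw [hcol₂ v hc]; exact h.col_le v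
  · exact hcl
  · intro hb v w hv hvw
    rw [ne_eq, hbad, not_or, not_exists] at hb
    rcases hst' v hv with rfl | hv
    · rw [hcol0 v hu]
      by_cases hw : col w = 0
      · rw [hcol₁ w ⟨hw, hvw⟩]; omega
      · rw [hcol0 w hw]
        exact fun he => hb.2 w ⟨hvw, he.symm⟩
    · have hw := h.closed v w hv hvw
      have hv0 : col v ≠ 0 := mt (h.status_iff v).2 (by omega)
      rw [hcol0 w hw, hcol0 v hv0]
      exact h.proper hb.1 v w hv hvw
  · intro χ hχ
    obtain ⟨hb, χ', hχ', hag⟩ := h.extends_ χ hχ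
    have hχu := hag u hu
    refine ⟨?_, χ', hχ', fun v hv => ?_⟩
    · rw [ne_eq, hbad]
      rintro (h1 | ⟨v, hv, hvc⟩)
      · exact hb h1
      · refine hχ'.2 u v hv ?_
        rw [hχu, hag v (by rwa [hvc]), hvc]
    -- The new colour is forced: with only two colours, `v` must differ from `u`.
    · by_cases hc : col v = 0 ∧ Gᶜ.Adj u v
      · rw [hcol₁ v hc]
        have h1 := hχ'.2 u v hc.2
        have h2 := hχ'.1 v
        rw [hχu] at h1
        clear hbad
        rw [hd]
        split_ifs <;> omega
      · rw [hcol₂ v hc] at hv ⊢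
        exact hag v hv

/-- The vertex is marked as treated before its neighbours in the complement are coloured, so the
final statuses need not satisfy the invariant. `st` is the status array just before this marking, to
which `ColourInv.treat` is applied. -/
theorem wp_pickVertex {s : State} (hin : HasInput L s) (hc : HasConsts s)
    (hI : ColourInv G (s.mem 7) (s.mem 8) (s.reg 28)) (hex : ∃ v : Fin n, s.mem 8 v ≠ 2) :
    WP pickVertex s fun t s' => t ≤ 10 * n + 20 ∧ ∃ u : Fin n, s'.reg 21 = u ∧ s.mem 8 u ≠ 2 ∧
      s'.reg 30 = s'.mem 7 u ∧ s'.reg 31 = (if s'.mem 7 u = 1 then 2 else 1) ∧ s'.mem 7 u ≠ 0 ∧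
      ∃ st, ColourInv G (s'.mem 7) st (s'.reg 28) ∧
        (∀ v : Fin n, st v = 2 ↔ s.mem 8 v = 2) ∧
        ∀ v : Fin n, s'.mem 8 v = if v = u then 2 else st v := by
  unfold pickVertex
  refine (wp_findEq hin.1 (by decide) (by decide)).seq ?_
  rintro t₁ s₁ hF₁ ⟨ht₁, h₁⟩
  have hin₁ := hin.of_frame hF₁
  have hc₁ := hc.of_frame hF₁
  refine (wp_findEq hin₁.1 (by decide) (by decide)).seq ?_
  rintro t₂ s₂ hF₂ ⟨ht₂, h₂⟩
  have hc₂ := hc₁.of_frame hF₂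
  rw [hc.1] at h₁
  rw [hc₁.2.1, hF₁.mem 8] at h₂
  have e7 : s₂.mem 7 = s.mem 7 := by rw [hF₂.mem 7, hF₁.mem 7]
  have e8 : s₂.mem 8 = s.mem 8 := by rw [hF₂.mem 8, hF₁.mem 8]
  have e28 : s₂.reg 28 = s.reg 28 := by rw [hF₂.reg 28, hF₁.reg 28]
  obtain ⟨u, hu, hu8⟩ : ∃ u : Fin n, s₂.reg 21 = u ∧
      ((s.mem 8 u = 0 ∧ ∀ v : Fin n, s.mem 8 v ≠ 1) ∨ s.mem 8 u = 1) := by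
    -- An uncoloured vertex is kept only if no coloured untreated vertex exists, which is the
    -- hypothesis of `ColourInv.start`.
    rcases h₂ with ⟨h2, h2'⟩ | ⟨u, h2, h2'⟩
    · rcases h₁ with ⟨h1, h1'⟩ | ⟨u, h1, h1'⟩
      · obtain ⟨v, hv⟩ := hex
        have := h1 v
        have := h2 v
        have := hI.status_le v
        omega
      · exact ⟨u, h2'.trans h1', .inl ⟨h1, h2⟩⟩
    · exact ⟨u, h2', .inr h2⟩
  simp only [wp_seq, wp_instr, wp_ite, wp_skip, Instr.exec, Test.Holds, State.reg_setReg, hu, hc₂.1,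
    State.reg_setMem, State.mem_setMem, State.mem_setReg, hc₂.2.1, hc₂.2.2.1, if_true, if_false,
    Nat.reduceEqDiff, e7, e8, e28, true_and, false_and]
  constructor
  · intro h0
    have hinv := hI.start (col' := fun j => if j = u then 1 else s.mem 7 j)
      (st' := fun j => if j = u then 1 else s.mem 8 j) h0 (hu8.resolve_right (by omega)).2
      (by simp [Fin.val_inj]) (by simp [Fin.val_inj])
    refine ⟨fun _ => ⟨by omega, u, rfl, by omega, by simp, by simp, by simp,
      fun j => if j = u then 1 else s.mem 8 j, hinv.congr (fun v => ?_) (fun _ => rfl), fun v => ?_, fun v => ?_⟩, fun h => absurd trivial h⟩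
    · simp [State.mem_setMem, State.mem_setReg, e7]
    · by_cases hv : v = u
      · simp [hv, h0]
      · simp [Fin.val_inj, hv]
    · by_cases hv : v = u <;> simp [Fin.val_inj, hv]
  · intro h0
    have hu1 : s.mem 8 u = 1 := hu8.resolve_left fun h => h0 h.1
    have hu7 : s.mem 7 u ≠ 0 := mt (hI.status_iff u).2 h0
    constructor <;> intro h7
    all_goals
      refine ⟨by omega, u, rfl, by omega, rfl, by simp [h7], hu7, _,
        hI.congr (fun v => ?_) (fun _ => rfl), fun v => Iff.rfl, fun v => ?_⟩
      · simp [State.mem_setMem, State.mem_setReg, e7]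
      · simp [Fin.val_inj]

theorem wp_markNeighbours (hL : IsAdjacencyList G L) {s : State} (hin : HasInput L s)
    (hc : HasConsts s) {u : Fin n} (hu : s.reg 21 = u) :
    WP markNeighbours s fun t s' => t ≤ 5 * n + 4 * adjOff L n + 8 ∧
      ∀ v : Fin n, s'.mem 9 v = 0 ↔ Gᶜ.Adj u v := by
  unfold markNeighbours
  refine (wp_mapIf hin.1 (by decide) (by decide) (by decide) (by decide)).seq ?_
  rintro t₁ s₁ hF₁ ⟨ht₁, h₁⟩
  have hin₁ := hin.of_frame hF₁
  have hc₁ := hc.of_frame hF₁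
  have f21 : s₁.reg 21 = u := (hF₁.reg 21).trans hu
  rw [hc.1] at h₁
  -- Both branches of the map write `0`: it clears array `9` from the previous round.
  simp only [ite_self] at h₁
  rw [wp_seq, wp_instr]
  simp only [Instr.exec, f21, hc₁.2.1]
  refine (WP.forAdj (L := L) (s := s₁.setMem 9 u 1) hin₁ u f21 1
    (fun k s' => ∀ v : Fin n, s'.mem 9 v = if v = u ∨ v ∈ (L u).take k then 1 else 0)
    (by decide) (by decide) (by decide) (by decide) (by decide) ?_ ?_).mono ?_
  · intro v
    simp [State.mem_setReg, State.mem_setMem, Fin.val_inj, h₁]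
  · intro k hk s' hF hI
    have f4 : s'.reg 4 = 1 := (hF.reg 4).trans hc₁.2.1
    simp only [wp_instr, Instr.exec, State.mem_setReg, State.reg_setReg, State.mem_setMem, f4,
      if_true, if_false, true_and, Nat.reduceEqDiff, le_refl, hI, Fin.val_inj,
      List.take_succ_eq_append_getElem hk, List.mem_append, List.mem_singleton]
    intro v
    by_cases h1 : v = (L u)[k]
    · simp [h1]
    · simp [h1]
  · rintro t s' - ⟨ht, hI⟩
    have hlen : (L u).length ≤ adjOff L n := by
      rw [adjOff_last]
      exact Finset.single_le_sum (f := fun v => (L v).length) (fun _ _ => Nat.zero_le _)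
        (Finset.mem_univ u)
    refine ⟨by omega, fun v => ?_⟩
    rw [hI, List.take_length, SimpleGraph.compl_adj, ← (hL u).2]
    split_ifs with h
    · refine iff_of_false (by simp) fun h' => h.elim (fun h => h'.1 h.symm) h'.2
    · exact iff_of_true rfl ⟨fun h' => h (.inl h'.symm), fun h' => h (.inr h')⟩

theorem wp_colourUnmarked {s : State} (hn : s.reg 0 = n) (hc : HasConsts s) :
    WP colourUnmarked s fun t s' => t ≤ 8 * n + 2 ∧
      (∀ v : Fin n, s'.mem 7 v = if s.mem 7 v = 0 ∧ s.mem 9 v = 0 then s.reg 31 else s.mem 7 v) ∧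
      (∀ v : Fin n, s'.mem 8 v = if s.mem 7 v = 0 ∧ s.mem 9 v = 0 then 1 else s.mem 8 v) ∧
      (s'.reg 28 = 1 ↔ s.reg 28 = 1 ∨ ∃ v : Fin n, s.mem 9 v = 0 ∧ s.mem 7 v ≠ 0 ∧
        s.mem 7 v = s.reg 30) := by
  unfold colourUnmarked
  refine (WP.forV (n := n) (fun k => 8 * k) (fun i s' =>
      (∀ v : Fin n, s'.mem 7 v =
        if (v : ℕ) < i ∧ s.mem 7 v = 0 ∧ s.mem 9 v = 0 then s.reg 31 else s.mem 7 v) ∧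
      (∀ v : Fin n, s'.mem 8 v =
        if (v : ℕ) < i ∧ s.mem 7 v = 0 ∧ s.mem 9 v = 0 then 1 else s.mem 8 v) ∧
      (s'.reg 28 = 1 ↔ s.reg 28 = 1 ∨ ∃ v : Fin n, (v : ℕ) < i ∧ s.mem 9 v = 0 ∧ s.mem 7 v ≠ 0 ∧
        s.mem 7 v = s.reg 30))
    (by decide) (by decide) hn rfl (by simp [State.mem_setReg, State.reg_setReg]) ?_).mono ?_
  · rintro i hi s' hF h7 ⟨hI7, hI8, hI28⟩
    have e3 : s'.reg 3 = 0 := (hF.reg 3).trans hc.1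
    have e4 : s'.reg 4 = 1 := (hF.reg 4).trans hc.2.1
    have e30 := hF.reg 30
    have e31 := hF.reg 31
    have e9 := hF.mem 9
    have g7 : s'.mem 7 i = s.mem 7 i := by simpa using hI7 ⟨i, hi⟩
    simp only [wp_seq, wp_instr, wp_ite, wp_skip, Instr.exec, Test.Holds, State.reg_setReg, h7,
      State.reg_setMem, State.mem_setMem, State.mem_setReg, if_true, if_false, Nat.reduceEqDiff,
      e3, e4, e30, e31, e9, g7, true_and, false_and, hI7, hI8, hI28]
    have hsplit : ∀ v : Fin n, (v : ℕ) < i + 1 ↔ (v : ℕ) = i ∨ (v : ℕ) < i := by omega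
    have hkeep : ¬ (s.mem 7 i = 0 ∧ s.mem 9 i = 0) → ∀ (v : Fin n) (x y : ℕ),
        (if (v : ℕ) < i ∧ s.mem 7 v = 0 ∧ s.mem 9 v = 0 then x else y) =
          if (v : ℕ) < i + 1 ∧ s.mem 7 v = 0 ∧ s.mem 9 v = 0 then x else y := by
      intro h v x y
      refine if_congr (and_congr_left fun hv => ?_) rfl rfl
      rw [hsplit]
      exact ⟨.inr, fun h' => h'.resolve_left fun h' => h (h' ▸ hv)⟩
    have hset : s.mem 7 i = 0 → s.mem 9 i = 0 → ∀ (v : Fin n) (x y : ℕ),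
        (if (v : ℕ) = i then x else
          if (v : ℕ) < i ∧ s.mem 7 v = 0 ∧ s.mem 9 v = 0 then x else y) =
          if (v : ℕ) < i + 1 ∧ s.mem 7 v = 0 ∧ s.mem 9 v = 0 then x else y := by
      intro h h' v x y
      by_cases hv : (v : ℕ) = i
      · simp [hv, h, h']
      · simp [hv, hsplit]
    have hbad : ¬ (s.mem 9 i = 0 ∧ s.mem 7 i ≠ 0 ∧ s.mem 7 i = s.reg 30) →
        ((∃ v : Fin n, (v : ℕ) < i ∧ s.mem 9 v = 0 ∧ s.mem 7 v ≠ 0 ∧ s.mem 7 v = s.reg 30) ↔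
          ∃ v : Fin n, (v : ℕ) < i + 1 ∧ s.mem 9 v = 0 ∧ s.mem 7 v ≠ 0 ∧ s.mem 7 v = s.reg 30) := by
      intro h
      refine exists_congr fun v => and_congr_left fun hv => ?_
      rw [hsplit]
      exact ⟨.inr, fun h' => h'.resolve_left fun h' => h (h' ▸ hv)⟩
    refine ⟨fun h9 => ⟨fun h70 => ?_, fun h70 => ⟨fun h730 => ?_, fun h730 => ?_⟩⟩, fun h9 => ?_⟩
    · exact ⟨by omega, fun v => hset h70 h9 v _ _, fun v => hset h70 h9 v _ _,
        or_congr_right (hbad fun h => h.2.1 h70)⟩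
    · exact ⟨by omega, fun v => hkeep (fun h => h70 h.1) v _ _, fun v => hkeep (fun h => h70 h.1) v _ _,
        iff_of_true trivial (.inr ⟨⟨i, hi⟩, Nat.lt_succ_self i, h9, h70, h730⟩)⟩
    · exact ⟨by omega, fun v => hkeep (fun h => h70 h.1) v _ _, fun v => hkeep (fun h => h70 h.1) v _ _,
        or_congr_right (hbad fun h => h730 h.2.2)⟩
    · exact ⟨by omega, fun v => hkeep (fun h => h9 h.2) v _ _, fun v => hkeep (fun h => h9 h.2) v _ _,
        or_congr_right (hbad fun h => h9 h.1)⟩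
  · rintro t s' - ⟨ht, h7, h8, h28⟩
    exact ⟨ht, by simpa using h7, by simpa using h8, by simpa using h28⟩

/-- Exactly one more vertex is treated, so `n` rounds treat all of them. -/
theorem wp_colourRound (hL : IsAdjacencyList G L) {s : State} (hin : HasInput L s) (hc : HasConsts s)
    (hI : ColourInv G (s.mem 7) (s.mem 8) (s.reg 28)) (hex : ∃ v : Fin n, s.mem 8 v ≠ 2) :
    WP (pickVertex ;; markNeighbours ;; colourUnmarked) s fun t s' =>
      t ≤ 23 * n + 4 * adjOff L n + 30 ∧ ColourInv G (s'.mem 7) (s'.mem 8) (s'.reg 28) ∧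
      (Finset.univ.filter fun v : Fin n => s'.mem 8 v = 2).card =
        (Finset.univ.filter fun v : Fin n => s.mem 8 v = 2).card + 1 := by
  refine (wp_pickVertex hin hc hI hex).seq ?_
  rintro t₁ s₁ hF₁ ⟨ht₁, u, hu, hu2, h30, h31, hu7, st, hI₁, hst, h8⟩
  have hin₁ := hin.of_frame hF₁
  have hc₁ := hc.of_frame hF₁
  refine (wp_markNeighbours hL hin₁ hc₁ hu).seq ?_
  rintro t₂ s₂ hF₂ ⟨ht₂, h9⟩
  have hin₂ := hin₁.of_frame hF₂
  have hc₂ := hc₁.of_frame hF₂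
  have e31 := hF₂.reg 31
  have e30 := hF₂.reg 30
  have e28 := hF₂.reg 28
  have e7 := hF₂.mem 7
  have e8 := hF₂.mem 8
  refine (wp_colourUnmarked hin₂.1 hc₂).mono ?_
  rintro t₃ s₃ - ⟨ht₃, h7', h8', hbad⟩
  have hcond : ∀ v : Fin n, (s₂.mem 7 v = 0 ∧ s₂.mem 9 v = 0) ↔ (s₁.mem 7 v = 0 ∧ Gᶜ.Adj u v) := by
    intro v; rw [e7, h9]
  simp only [e30, e28, e7, h9] at hbad
  have hinv : ColourInv G (s₃.mem 7) (s₃.mem 8) (s₃.reg 28) := by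
    refine hI₁.treat (d := s₁.reg 31) hu7 h31 ?_ ?_ ?_ ?_ ?_
    · intro v hv; rw [h8', if_pos ((hcond v).2 hv)]
    · intro v hv; rw [h8', if_neg (mt (hcond v).1 hv), e8, h8]
    · intro v hv; rw [h7', if_pos ((hcond v).2 hv), e31]
    · intro v hv; rw [h7', if_neg (mt (hcond v).1 hv), e7]
    · rw [hbad, h30]
      refine or_congr_right (exists_congr fun v => and_congr_right fun _ => ?_)
      exact ⟨And.right, fun h => ⟨by rwa [h], h⟩⟩
  refine ⟨by omega, hinv, ?_⟩
  have : (Finset.univ.filter fun v : Fin n => s₃.mem 8 v = 2) =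
      insert u (Finset.univ.filter fun v : Fin n => s.mem 8 v = 2) := by
    ext v
    simp only [Finset.mem_filter, Finset.mem_univ, true_and, Finset.mem_insert, ← hst]
    rw [h8', e8, h8]
    split_ifs with h1 h2
    · replace h1 := (hcond v).1 h1
      refine iff_of_false (by simp) ?_
      rintro (rfl | hv)
      · exact hu7 h1.1
      · have := (hI₁.status_iff v).2 h1.1
        omega
    · simp [h2]
    · simp [h2]
  rw [this, Finset.card_insert_of_notMem (by simpa using hu2)]

theorem wp_colourComplement (hL : IsAdjacencyList G L) {s : State} (hin : HasInput L s)
    (hc : HasConsts s) (h7 : s.mem 7 = 0) (h8 : s.mem 8 = 0) :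
    WP colourComplement s fun t s' => t ≤ n * (23 * n + 4 * adjOff L n + 32) + 3 ∧
      (s'.reg 28 = 1 ↔ ¬ IsCoBipartite G) := by
  unfold colourComplement
  rw [wp_seq, wp_instr]
  refine (WP.forV (n := n) (fun k => k * (23 * n + 4 * adjOff L n + 32))
    (fun i s' => ColourInv G (s'.mem 7) (s'.mem 8) (s'.reg 28) ∧
      (Finset.univ.filter fun v : Fin n => s'.mem 8 v = 2).card = i)
    (by decide) (by decide) (by simpa [Instr.exec, State.reg_setReg] using hin.1) (by simp)
    ?_ ?_).mono ?_
  · simp only [Instr.exec, State.mem_setReg, State.reg_setReg, h7, h8, Nat.reduceEqDiff, if_false,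
      if_true]
    refine ⟨⟨by simp, by simp, by simp, by simp, by simp, fun χ hχ => ⟨by simp, χ, hχ, by simp⟩⟩,
      by simp⟩
  · rintro i hi s' hF - ⟨hI, hcard⟩
    have hin' : HasInput L s' := HasInput.of_frame (s := (Instr.const 28 0).exec s) hin hF
    have hc' : HasConsts s' := HasConsts.of_frame (s := (Instr.const 28 0).exec s) hc hF
    have hex : ∃ v : Fin n, s'.mem 8 v ≠ 2 := by
      by_contra hno
      push Not at hno
      rw [Finset.filter_true_of_mem fun v _ => hno v, Finset.card_univ, Fintype.card_fin] at hcard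
      omega
    refine (wp_colourRound hL hin' hc' hI hex).mono ?_
    rintro t s₁ - ⟨ht, hI₁, hcard₁⟩
    refine ⟨?_, hI₁, hcard₁.trans (congrArg (· + 1) hcard)⟩
    rw [Nat.succ_mul i]
    omega
  · rintro t s' - ⟨ht, hI, hcard⟩
    refine ⟨by omega, ?_⟩
    have hall : ∀ v : Fin n, s'.mem 8 v = 2 := by
      have : (Finset.univ.filter fun v : Fin n => s'.mem 8 v = 2) = Finset.univ :=
        Finset.eq_univ_of_card _ (by rw [hcard, Fintype.card_fin])
      intro v
      have hv : v ∈ (Finset.univ.filter fun v : Fin n => s'.mem 8 v = 2) := by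
        rw [this]; exact Finset.mem_univ v
      simpa using hv
    rw [isCoBipartite_iff]
    constructor
    -- A conflict is incompatible with `extends_`; without one, all vertices are treated and the
    -- computed colours themselves are proper.
    · rintro hb ⟨χ, hχ⟩
      exact (hI.extends_ χ hχ).1 hb
    · intro hno
      by_contra hb
      refine hno ⟨fun v => s'.mem 7 v, fun v => ?_, fun u w huw => hI.proper hb u w (hall u) huw⟩
      have h1 := hI.col_le v
      have h2 := mt (hI.status_iff v).2 (by rw [hall v]; norm_num)
      simp only
      omega

end Colour

/-! ### The algorithm -/

/-- Search for a clique separator. -/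
def search : Program :=
  .loop (.lt 2 0) round

/-- Decide whether there is an m-convex 2-cover once the search is over. -/
def answer : Program :=
  .ite (.eq 1 4) (.instr (.const 0 1))
    (.ite (.lt 0 5) (.instr (.const 0 0))
      (colourComplement ;; .ite (.eq 28 4) (.instr (.const 0 0)) (.instr (.const 0 1))))

/-- Search for a clique separator and decide whether there is an m-convex 2-cover. -/
def coverProgram : Program :=
  .instr (.const 4 1) ;; .instr (.const 5 2) ;; .instr (.const 6 3) ;; search ;; answer

section Main

variable {n : ℕ} {G : SimpleGraph (Fin n)} {L : Fin n → List (Fin n)}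

/-- The disjunction in the time bound separates a halt in the first round, possible for disconnected
graphs, from longer runs, where the graph is known to be connected. -/
theorem wp_search (hL : IsAdjacencyList G L) {s : State} (h : SearchInv G L s) (h2 : s.reg 2 = 0) :
    WP search s fun t s' => HasInput L s' ∧ HasConsts s' ∧
      ((s'.reg 1 = 0 ∧ (¬ ∃ K, IsCliqueSeparator G K) ∧ (n = 0 ∨ G.Preconnected) ∧
          t ≤ n * (76 * n + 31 * adjOff L n + 41) + 1) ∨
        (s'.reg 1 = 1 ∧ IsCliqueSeparator G {v : Fin n | s'.mem 2 v = 1} ∧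
          (t ≤ 76 * n + 31 * adjOff L n + 42 ∨
            G.Preconnected ∧ t ≤ n * (76 * n + 31 * adjOff L n + 41) + 1))) := by
  unfold search
  set B := 76 * n + 31 * adjOff L n + 41 with hB
  refine (WP.loop (fun t s' => (SearchInv G L s' ∧ s'.reg 2 ≤ n ∧ t ≤ s'.reg 2 * B) ∨
      (HasInput L s' ∧ HasConsts s' ∧ s'.reg 1 = 1 ∧ s'.reg 2 = n ∧
        IsCliqueSeparator G {v : Fin n | s'.mem 2 v = 1} ∧
        (t ≤ B ∨ G.Preconnected ∧ t ≤ n * B)))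
    (fun s' => n - s'.reg 2) (.inl ⟨h, by omega, by simp⟩) ?_).mono ?_
  · rintro t s' - (⟨hI, hle, ht⟩ | hI) hb
    · simp only [Test.Holds, hI.input.1] at hb
      refine (wp_round hL hI hb).mono ?_
      have hmul : (s'.reg 2 + 1) * B = s'.reg 2 * B + B := Nat.succ_mul _ _
      rintro t₁ s₁ - ⟨ht₁, ⟨hI₁, h2₁, -⟩ | ⟨hin, hc, h1, h2₁, hK⟩⟩
      · refine ⟨.inl ⟨hI₁, by omega, ?_⟩, by omega⟩
        rw [h2₁, hmul]
        omega
      · refine ⟨.inr ⟨hin, hc, h1, h2₁, hK, ?_⟩, by omega⟩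
        by_cases h0 : s'.reg 2 = 0
        · rw [h0] at ht
          exact .inl (by omega)
        · have := Nat.mul_le_mul_right B (show s'.reg 2 + 1 ≤ n from hb)
          exact .inr ⟨hI.preconnected h0, by omega⟩
    · simp only [Test.Holds, hI.1.1, hI.2.2.2.1, lt_irrefl] at hb
  · rintro t s' - ⟨t₀, rfl, ⟨hI, hle, ht⟩ | ⟨hin, hc, h1, h2, hK, ht⟩, hb⟩
    · simp only [Test.Holds, hI.input.1, not_lt] at hb
      have hn : s'.reg 2 = n := by omega
      rw [hn] at ht
      refine ⟨hI.input, hI.consts, .inl ⟨hI.not_found, ?_, ?_, by omega⟩⟩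
      · refine Inseparable.not_isCliqueSeparator ?_
        convert hI.inseparable
        have hcard := hI.card_eq
        rw [hn] at hcard
        have huniv := Finset.eq_univ_of_card _ (hcard.symm.trans (Fintype.card_fin n).symm)
        refine (Set.eq_univ_of_forall fun v => ?_).symm
        have hv : v ∈ (Finset.univ.filter fun v : Fin n => s'.mem 3 v ≠ 0) := by
          rw [huniv]; exact Finset.mem_univ v
        simpa using hv
      · by_cases h0 : n = 0
        · exact .inl h0
        · exact .inr (hI.preconnected (by omega))
    · exact ⟨hin, hc, .inr ⟨h1, hK, ht.imp (by omega) fun ⟨h, h'⟩ => ⟨h, by omega⟩⟩⟩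

theorem wp_answer (hL : IsAdjacencyList G L) {s : State} (hin : HasInput L s) (hc : HasConsts s)
    (h7 : s.mem 7 = 0) (h8 : s.mem 8 = 0)
    (h1 : (s.reg 1 = 0 ∧ ¬ ∃ K, IsCliqueSeparator G K) ∨
      (s.reg 1 = 1 ∧ ∃ K, IsCliqueSeparator G K)) :
    WP answer s fun t s' => (s.reg 1 = 1 → t ≤ 2) ∧
      t ≤ n * (23 * n + 4 * adjOff L n + 32) + 7 ∧
      (HasMConvexCover G 2 → s'.reg 0 = 1) ∧ (¬ HasMConvexCover G 2 → s'.reg 0 = 0) := by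
  unfold answer
  simp only [wp_ite, wp_instr, Test.Holds, Instr.exec, State.reg_setReg, if_true, hin.1, hc.2.1,
    hc.2.2.1]
  refine ⟨fun h => ?_, fun h => ⟨fun hn => ?_, fun hn => ?_⟩⟩
  · obtain ⟨K, hK⟩ := (h1.resolve_left fun h' => by omega).2
    exact ⟨fun _ => le_rfl, by omega, fun _ => trivial,
      fun h => absurd (hasMConvexCover_of_isCliqueSeparator hK) h⟩
  · refine ⟨fun h' => absurd h' h, by omega, fun hcov => ?_, fun _ => trivial⟩
    -- With at most one vertex, two proper subsets miss the same vertex and cannot cover it.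
    obtain ⟨A, B, -, -, hA, hB, hU⟩ := hasMConvexCover_two_iff.1 hcov
    obtain ⟨a, ha⟩ := (Set.ne_univ_iff_exists_notMem A).1 hA
    obtain ⟨b, hb⟩ := (Set.ne_univ_iff_exists_notMem B).1 hB
    have hab : a = b := Fin.ext (by have := a.2; have := b.2; omega)
    subst hab
    exact ((hU ▸ Set.mem_univ a : a ∈ A ∪ B).elim ha hb).elim
  · have hsep := (h1.resolve_right fun h' => h h'.1).2
    have : Nontrivial (Fin n) := Fin.nontrivial_iff_two_le.2 (by omega)
    rw [hasMConvexCover_iff_isCoBipartite hsep]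
    refine (wp_colourComplement hL hin hc h7 h8).seq ?_
    rintro t₁ s₁ hF₁ ⟨ht₁, hco⟩
    have hc₁ := hc.of_frame hF₁
    simp only [wp_ite, wp_instr, Test.Holds, Instr.exec, State.reg_setReg, if_true, hc₁.2.1, hco,
      not_not]
    exact ⟨fun h' => ⟨fun h'' => absurd h'' h, by omega, fun hh => absurd hh h', fun _ => trivial⟩,
      fun h' => ⟨fun h'' => absurd h'' h, by omega, fun _ => trivial, fun hh => absurd h' hh⟩⟩

theorem le_of_preconnected (h : n = 0 ∨ G.Preconnected) : n ≤ G.edgeSet.ncard + 1 := by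
  by_cases h0 : n = 0
  · omega
  · have : Nonempty (Fin n) := ⟨⟨0, by omega⟩⟩
    have hc : G.Connected := ⟨h.resolve_left h0⟩
    simpa using hc.card_vert_le_card_edgeSet_add_one

theorem coverProgram_solvesWithin (hL : IsAdjacencyList G L) :
    SolvesWithin coverProgram G L (400 * (max n 1 * max G.edgeSet.ncard 1)) := by
  set m := G.edgeSet.ncard with hm
  set P := max n 1 * max m 1 with hP
  have hM : adjOff L n = 2 * m := (adjOff_last L).trans (sum_length_eq hL)
  have hP1 : 1 ≤ P := Nat.mul_pos (by omega) (by omega)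
  have hPn : n ≤ P := (le_max_left n 1).trans (Nat.le_mul_of_pos_right _ (by omega))
  have hPm : m ≤ P := (le_max_left m 1).trans (Nat.le_mul_of_pos_left _ (by omega))
  have hbig : n = 0 ∨ G.Preconnected → n * (76 * n + 31 * adjOff L n + 41) +
      n * (23 * n + 4 * adjOff L n + 32) ≤ 341 * P := by
    intro h
    have h1 := le_of_preconnected h
    -- From `n ≤ m + 1` the left side is at most `169 * m + 172`, and `169 + 172 = 341`. The
    -- remaining steps up to `400` cover the additive constants.
    have h2 : 99 * n + 70 * m + 73 ≤ 341 * max m 1 := by omega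
    calc n * (76 * n + 31 * adjOff L n + 41) + n * (23 * n + 4 * adjOff L n + 32)
        = n * (99 * n + 70 * m + 73) := by rw [hM]; ring
      _ ≤ max n 1 * (341 * max m 1) := Nat.mul_le_mul (le_max_left n 1) h2
      _ = 341 * P := by rw [hP]; ring
  suffices h : WP coverProgram (inputState L) fun t s => t ≤ 400 * P ∧
      (HasMConvexCover G 2 → s.reg 0 = 1) ∧ (¬ HasMConvexCover G 2 → s.reg 0 = 0) ∧
      ((∃ K, IsCliqueSeparator G K) →
        s.reg 1 = 1 ∧ IsCliqueSeparator G {v : Fin n | s.mem 2 v = 1}) ∧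
      ((¬ ∃ K, IsCliqueSeparator G K) → s.reg 1 = 0) by
    exact h
  unfold coverProgram
  simp only [wp_seq, wp_instr, Instr.exec]
  set s₀ := (((inputState L).setReg 4 1).setReg 5 2).setReg 6 3 with hs₀
  have hmem : ∀ a, a ≠ 0 → a ≠ 1 → s₀.mem a = 0 := by
    intro a h0 h1
    ext i
    simp [hs₀, State.mem_setReg, inputState, h0, h1]
  have hinv : SearchInv G L s₀ := by
    refine ⟨⟨?_, rfl, rfl⟩, ⟨?_, ?_, ?_, ?_⟩, ?_, ?_, ?_, ?_⟩
    any_goals simp [hs₀, State.reg_setReg, State.mem_setReg, inputState]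
    exact inseparable_empty
  refine (wp_search hL hinv (by simp [hs₀, State.reg_setReg, inputState])).mono ?_
  rintro t₁ s₁ hF₁ ⟨hin₁, hc₁, h₁⟩
  refine (wp_answer hL hin₁ hc₁ ((hF₁.mem 7).trans (hmem 7 (by decide) (by decide)))
    ((hF₁.mem 8).trans (hmem 8 (by decide) (by decide))) ?_).mono ?_
  · exact h₁.imp (fun h => ⟨h.1, h.2.1⟩) fun h => ⟨h.1, _, h.2.1⟩
  · rintro t₂ s₂ hF₂ ⟨ht₂, ht₂', hy, hno⟩
    have e1 := hF₂.reg 1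
    have e2 := hF₂.mem 2
    rw [e1, e2]
    refine ⟨?_, hy, hno, ?_, ?_⟩
    · rcases h₁ with ⟨-, -, hp, ht₁⟩ | ⟨h1, -, ht₁ | ⟨hp, ht₁⟩⟩
      · have := hbig hp
        omega
      · have := ht₂ h1
        omega
      · have := hbig (.inr hp)
        have := ht₂ h1
        omega
    · exact fun hK => (h₁.resolve_left fun h => h.2.1 hK).imp id And.left
    · exact fun hK => (h₁.resolve_right fun h => hK ⟨_, h.2.1⟩).1

end Main
end MonophonicCover

theorem mainTheorem6 :
    -- one program decides the problem for all graphs in time `O(n m)`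
    (∃ (p : Program) (C : ℕ), ∀ (n : ℕ) (G : SimpleGraph (Fin n)) (L : Fin n → List (Fin n)),
      IsAdjacencyList G L →
        SolvesWithin p G L (C * (max n 1 * max G.edgeSet.ncard 1))) ∧
    -- a clique separator yields an m-convex 2-cover
    (∀ (V : Type*) [Finite V] (G : SimpleGraph V),
      (∃ K, IsCliqueSeparator G K) → HasMConvexCover G 2) ∧
    -- without one, an m-convex 2-cover exists exactly if the graph is co-bipartite
    (∀ (V : Type*) [Finite V] [Nontrivial V] (G : SimpleGraph V),
      (¬ ∃ K, IsCliqueSeparator G K) → (HasMConvexCover G 2 ↔ IsCoBipartite G)) :=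
  ⟨⟨coverProgram, 400, fun _ _ _ hL => coverProgram_solvesWithin hL⟩,
    fun _ _ _ ⟨_, hK⟩ => hasMConvexCover_of_isCliqueSeparator hK,
    fun _ _ _ _ hsep => hasMConvexCover_iff_isCoBipartite hsep⟩
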